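/- Let $\varphi(\xi)=\frac{\xi}{1+\xi^2}$ and let $S(t)=e^{-it\varphi(D)}$, $t\in\mathbb{R}$, be the linear BBM group on $\mathbb{R}$, that is, $\widehat{S(t)f}(\xi)=e^{-it\varphi(\xi)}\widehat f(\xi)$, where $\widehat f(\xi)=\int_{\mathbb{R}}e^{-ix\xi}f(x)\,dx$. For $\sigma\in\mathbb{R}$ and $1\le p\le\infty$ let $\|u\|_{H^\sigma_p}=\|J^\sigma u\|_{L^p(\mathbb{R})}$, where $J^\sigma=(1-\partial_x^2)^{\sigma/2}$ is the Fourier multiplier with symbol $(1+\xi^2)^{\sigma/2}$. For $\sigma<-1$ put \[ \beta_\sigma=\begin{cases}\dfrac{\sigma+1}{1-2\sigma}, & -4\le\sigma<-1,\\[2mm] \dfrac{-3}{1-2\sigma}, & \sigma\le-4.\end{cases} \] Then for every $\sigma<-1$ there is a constant $C_\sigma>0$, depending only on $\sigma$, such that for all $2\le p\le\infty$ with $\frac1p+\frac1{p'}=1$, \[ \|S(t)f\|_{H^\sigma_p}\le C_\sigma\,|t|^{2\left(\frac12-\frac1p\right)\beta_\sigma}\,\|f\|_{L^{p'}} \] for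 all Schwartz functions $f\in\mathscr{S}(\mathbb{R})$ and all $t\neq0$. -/

import Mathlib

open MeasureTheory
open scoped ENNReal SchwartzMap

noncomputable section

namespace BBM

/-- The exponent `β_σ` (for `σ < -1`): `(σ + 1) / (1 - 2σ)` if `-4 ≤ σ`, and `-3 / (1 - 2σ)` if
`σ ≤ -4`; the two formulas agree at `σ = -4`. -/
def beta (σ : ℝ) : ℝ :=
  if -4 ≤ σ then (σ + 1) / (1 - 2 * σ) else -3 / (1 - 2 * σ)

/-- The dispersion relation `φ(ξ) = ξ / (1 + ξ²)`. -/
def phi (ξ : ℝ) : ℝ := ξ / (1 + ξ ^ 2)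

/-- The Fourier multiplier `m(D)`, `D = -i d/dx`, on tempered distributions on `ℝ`. Mathlib's
Fourier transform is `∫ e^{-2πixξ} f(x) dx`, for which `D` has the symbol `2πξ`. The definition is
meaningful for symbols of temperate growth. -/
def multiplier (m : ℝ → ℂ) : 𝓢'(ℝ, ℂ) →L[ℂ] 𝓢'(ℝ, ℂ) :=
  TemperedDistribution.fourierMultiplierCLM ℂ (fun ξ : ℝ ↦ m (2 * Real.pi * ξ))

/-- The symbol `e^{-itφ(ξ)}`. -/
def groupSymbol (t : ℝ) (ξ : ℝ) : ℂ := Complex.exp (-Complex.I * t * phi ξ)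

/-- The symbol `(1 + ξ²)^{σ/2}`. -/
def besselSymbol (σ : ℝ) (ξ : ℝ) : ℂ := ((1 + ξ ^ 2) ^ (σ / 2) : ℝ)

/-- The BBM group `S(t) = e^{-itφ(D)}`. -/
def group (t : ℝ) : 𝓢'(ℝ, ℂ) →L[ℂ] 𝓢'(ℝ, ℂ) := multiplier (groupSymbol t)

/-- The Bessel potential `J^σ = (1 - d²/dx²)^{σ/2}`. (Mathlib's `besselPotential` is
`(1 - (2π)⁻² d²/dx²)^{σ/2}`.) -/
def bessel (σ : ℝ) : 𝓢'(ℝ, ℂ) →L[ℂ] 𝓢'(ℝ, ℂ) := multiplier (besselSymbol σ)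

/-- The norm `‖u‖_{H^σ_p} = ‖J^σ u‖_{L^p}` of a tempered distribution `u`, for `1 ≤ p ≤ ∞`. It is
the `L^p` norm of the function `g ∈ L^p` (unique almost everywhere) that represents `J^σ u`, and
`∞` if there is none. -/
def sobolevNorm (σ : ℝ) (p : ℝ≥0∞) (u : 𝓢'(ℝ, ℂ)) : ℝ≥0∞ :=
  ⨅ (g : ℝ → ℂ) (_ : MemLp g p volume)
    (_ : ∀ ψ : 𝓢(ℝ, ℂ), bessel σ u ψ = ∫ x, ψ x * g x), eLpNorm g p volume

/-! The symbols above have temperate growth, so that the operators are the intended ones. -/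

theorem hasTemperateGrowth_exp_I :
    (fun x : ℝ ↦ Complex.exp (x * Complex.I)).HasTemperateGrowth := by
  have hd : ∀ n : ℕ, iteratedDeriv n (fun x : ℝ ↦ Complex.exp (x * Complex.I)) =
      fun x : ℝ ↦ Complex.I ^ n * Complex.exp (x * Complex.I) := by
    intro n
    induction n with
    | zero => simp
    | succ n ih =>
      rw [iteratedDeriv_succ, ih]
      funext x
      have h1 : HasDerivAt (fun x : ℝ ↦ (x : ℂ) * Complex.I) Complex.I x := by
        simpa using (Complex.ofRealCLM.hasDerivAt (x := x)).mul_const Complex.I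
      have h2 := (h1.cexp).const_mul (Complex.I ^ n)
      rw [h2.deriv]
      ring
  refine ⟨?_, fun n ↦ ⟨0, 1, fun x ↦ ?_⟩⟩
  · exact (Complex.ofRealCLM.contDiff.mul contDiff_const).cexp
  · rw [norm_iteratedFDeriv_eq_norm_iteratedDeriv, hd]
    simp [Complex.norm_exp]

theorem hasTemperateGrowth_one_add_sq_rpow (r : ℝ) :
    (fun ξ : ℝ ↦ (1 + (2 * Real.pi * ξ) ^ 2) ^ r).HasTemperateGrowth := by
  have h := (Function.hasTemperateGrowth_one_add_norm_sq_rpow ℝ r).comp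
    (f := fun ξ : ℝ ↦ 2 * Real.pi * ξ) (by fun_prop)
  simpa [Function.comp_def, Real.norm_eq_abs, sq_abs] using h

theorem hasTemperateGrowth_besselSymbol (σ : ℝ) :
    (fun ξ : ℝ ↦ besselSymbol σ (2 * Real.pi * ξ)).HasTemperateGrowth :=
  Function.Complex.hasTemperateGrowth_ofReal.comp (hasTemperateGrowth_one_add_sq_rpow (σ / 2))

theorem hasTemperateGrowth_groupSymbol (t : ℝ) :
    (fun ξ : ℝ ↦ groupSymbol t (2 * Real.pi * ξ)).HasTemperateGrowth := by
  have h1 := hasTemperateGrowth_one_add_sq_rpow (-1)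
  have h2 : (fun ξ : ℝ ↦ (-t * (2 * Real.pi * ξ)) *
      (1 + (2 * Real.pi * ξ) ^ 2) ^ (-1 : ℝ)).HasTemperateGrowth := by
    refine Function.HasTemperateGrowth.mul ?_ h1
    fun_prop
  convert hasTemperateGrowth_exp_I.comp h2 using 1
  funext ξ
  simp only [groupSymbol, phi, Function.comp_def, Real.rpow_neg_one]
  congr 1
  push_cast
  ring

end BBM

end

/-!
The convolution kernel of `J^σ S(t)` is, up to a constant, the oscillatory integral
`∫ (1 + η²)^{σ/2} e^{i(xη - tφ(η))} dη`, and `x` does not enter the second derivative of its phase,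
so van der Corput's second derivative test bounds it uniformly in `x`. Since `φ''` vanishes to first
order at `0` and `±√3`, the part `|η| ≤ 3` is `O(|t|^{-1/3})`. For `η ≥ 3`, where `φ''(η) ~ 2η⁻³`,
the test on `[3, N]` gives `O(N^{3/2} |t|^{-1/2})` and the tail is `O(N^{σ+1})`; these balance at
`N ~ |t|^{1/(1-2σ)}`, with the value `|t|^{(σ+1)/(1-2σ)}`. Young's inequality turns the kernel bound
into an `L¹ → L^∞` bound for `J^σ S(t)`, which is also a contraction of `L²` because its symbol has
modulus at most `1`, and Riesz–Thorin interpolation gives the intermediate exponents.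
-/

namespace BBM

open Set

section OscillatoryIntegrals

variable {f f' f'' : ℝ → ℝ} {a b l : ℝ}

theorem norm_integral_smul_le_of_deriv_nonpos {E : Type*} [NormedAddCommGroup E] [NormedSpace ℝ E]
    [CompleteSpace E] {g : ℝ → E} {w w' : ℝ → ℝ} {M : ℝ} (hab : a ≤ b)
    (hg : ContinuousOn g (Icc a b)) (hM : ∀ y ∈ Icc a b, ‖∫ x in a..y, g x‖ ≤ M)
    (hw : ∀ x ∈ Icc a b, HasDerivAt w (w' x) x) (hw' : ∀ x ∈ Icc a b, w' x ≤ 0) (hwb : 0 ≤ w b) :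
    ‖∫ x in a..b, w x • g x‖ ≤ M * w a := by
  have hgi : IntervalIntegrable g volume a b := hg.intervalIntegrable_of_Icc hab
  have hwc : ContinuousOn w (Icc a b) := fun x hx ↦ (hw x hx).continuousAt.continuousWithinAt
  have hwi : IntervalIntegrable w' volume a b := by
    rw [← neg_neg w']
    refine ((intervalIntegrable_iff_integrableOn_Ioc_of_le hab).2 ?_).neg
    exact intervalIntegral.integrableOn_deriv_of_nonneg hwc.neg
      (fun x hx ↦ (hw x (Ioo_subset_Icc_self hx)).neg)
      (fun x hx ↦ neg_nonneg.2 (hw' x (Ioo_subset_Icc_self hx)))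
  have hGderiv : ∀ x ∈ Ioo a b, HasDerivAt (fun y ↦ ∫ x in a..y, g x) (g x) x := fun x hx ↦
    intervalIntegral.integral_hasDerivAt_right
      (hgi.mono_set (uIcc_subset_uIcc_left (Icc_subset_uIcc (Ioo_subset_Icc_self hx))))
      ((hg.mono Ioo_subset_Icc_self).stronglyMeasurableAtFilter isOpen_Ioo x hx)
      (hg.continuousAt (Icc_mem_nhds hx.1 hx.2))
  have parts := intervalIntegral.integral_smul_deriv_eq_deriv_smul_of_hasDerivAt
    (u := w) (u' := w') (by rwa [uIcc_of_le hab])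
    (intervalIntegral.continuousOn_primitive_interval' hgi left_mem_uIcc)
    (fun x hx ↦ hw x (Ioo_subset_Icc_self (by simpa [hab] using hx)))
    (fun x hx ↦ hGderiv x (by simpa [hab] using hx)) hwi hgi
  have remainder : ‖∫ x in a..b, w' x • ∫ y in a..x, g y‖ ≤ M * (w a - w b) := calc
    _ ≤ ∫ x in a..b, M * -w' x := by
      refine intervalIntegral.norm_integral_le_of_norm_le hab
        (.of_forall fun x hx ↦ ?_) (hwi.neg.const_mul M)
      have hx := Ioc_subset_Icc_self hx
      rw [norm_smul, Real.norm_of_nonpos (hw' x hx), mul_comm]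
      exact mul_le_mul_of_nonneg_right (hM x hx) (neg_nonneg.2 (hw' x hx))
    _ = M * (w a - w b) := by
      rw [intervalIntegral.integral_const_mul, intervalIntegral.integral_neg,
        intervalIntegral.integral_eq_sub_of_hasDerivAt_of_le hab hwc
          (fun x hx ↦ hw x (Ioo_subset_Icc_self hx)) hwi, neg_sub]
  calc ‖∫ x in a..b, w x • g x‖
      ≤ ‖w b • ∫ x in a..b, g x‖ + ‖∫ x in a..b, w' x • ∫ y in a..x, g y‖ := by
        rw [parts, intervalIntegral.integral_same, smul_zero, sub_zero]
        exact norm_sub_le _ _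
    _ ≤ w b * M + M * (w a - w b) := by
        rw [norm_smul, Real.norm_of_nonneg hwb]
        exact add_le_add (mul_le_mul_of_nonneg_left (hM b (right_mem_Icc.2 hab)) hwb) remainder
    _ = M * w a := by ring

theorem continuousOn_cexp_mul_I (hf : ∀ x ∈ Icc a b, HasDerivAt f (f' x) x) :
    ContinuousOn (fun x ↦ Complex.exp (f x * Complex.I)) (Icc a b) := by
  have : ContinuousOn f (Icc a b) := fun x hx ↦ (hf x hx).continuousAt.continuousWithinAt
  fun_prop

theorem norm_integral_cexp_le_length (hab : a ≤ b) :
    ‖∫ x in a..b, Complex.exp (f x * Complex.I)‖ ≤ b - a := by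
  have := intervalIntegral.norm_integral_le_of_norm_le_const (a := a) (b := b) (C := 1)
    (f := fun x ↦ Complex.exp (f x * Complex.I)) fun x _ ↦ (Complex.norm_exp_ofReal_mul_I _).le
  rwa [one_mul, abs_of_nonneg (sub_nonneg.2 hab)] at this

theorem norm_integral_cexp_neg :
    ‖∫ x in a..b, Complex.exp ((-f x : ℝ) * Complex.I)‖ =
      ‖∫ x in a..b, Complex.exp (f x * Complex.I)‖ := by
  rw [← RCLike.norm_conj (∫ x in a..b, Complex.exp (f x * Complex.I)),
    ← intervalIntegral.intervalIntegral_conj]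
  simp only [← Complex.exp_conj, map_mul, Complex.conj_ofReal, Complex.conj_I, Complex.ofReal_neg,
    neg_mul, mul_neg]

theorem norm_integral_cexp_le_two_div_deriv (hab : a ≤ b)
    (hf : ∀ x ∈ Icc a b, HasDerivAt f (f' x) x) (hf' : ∀ x ∈ Icc a b, HasDerivAt f' (f'' x) x)
    (hf'' : ∀ x ∈ Icc a b, 0 ≤ f'' x) (ha : 0 < f' a) :
    ‖∫ x in a..b, Complex.exp (f x * Complex.I)‖ ≤ 2 / f' a := by
  have hf'c : ContinuousOn f' (Icc a b) := fun x hx ↦ (hf' x hx).continuousAt.continuousWithinAt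
  have hmono : MonotoneOn f' (Icc a b) := monotoneOn_of_hasDerivWithinAt_nonneg (convex_Icc a b)
    hf'c (fun x hx ↦ (hf' x (interior_subset hx)).hasDerivWithinAt)
    fun x hx ↦ hf'' x (interior_subset hx)
  have hpos : ∀ x ∈ Icc a b, 0 < f' x := fun x hx ↦
    ha.trans_le (hmono (left_mem_Icc.2 hab) hx hx.1)
  have hgc : ContinuousOn (fun x ↦ f' x • Complex.exp (f x * Complex.I)) (Icc a b) :=
    hf'c.smul (continuousOn_cexp_mul_I hf)
  have primitive_le : ∀ y ∈ Icc a b, ‖∫ x in a..y, f' x • Complex.exp (f x * Complex.I)‖ ≤ 2 := by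
    intro y hy
    have hsub : Icc a y ⊆ Icc a b := Icc_subset_Icc_right hy.2
    have hprim : ∀ x ∈ uIcc a y, HasDerivAt (fun x ↦ -Complex.I * Complex.exp (f x * Complex.I))
        (f' x • Complex.exp (f x * Complex.I)) x := fun x hx ↦ by
      rw [uIcc_of_le hy.1] at hx
      refine ((((hf x (hsub hx)).ofReal_comp.mul_const Complex.I).cexp).const_mul
        (-Complex.I)).congr_deriv ?_
      rw [Complex.real_smul]
      linear_combination (-f' x * Complex.exp (f x * Complex.I)) * Complex.I_mul_I
    rw [intervalIntegral.integral_eq_sub_of_hasDerivAt hprim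
      ((hgc.mono hsub).intervalIntegrable_of_Icc hy.1)]
    refine (norm_sub_le _ _).trans (le_of_eq ?_)
    simp only [norm_mul, norm_neg, Complex.norm_I, Complex.norm_exp_ofReal_mul_I]
    norm_num
  have unweighted : ∫ x in a..b, Complex.exp (f x * Complex.I) =
      ∫ x in a..b, (f' x)⁻¹ • f' x • Complex.exp (f x * Complex.I) :=
    intervalIntegral.integral_congr fun x hx ↦
      (inv_smul_smul₀ (hpos x (by rwa [uIcc_of_le hab] at hx)).ne' _).symm
  rw [unweighted, div_eq_mul_inv]
  exact norm_integral_smul_le_of_deriv_nonpos hab hgc primitive_le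
    (fun x hx ↦ (hf' x hx).fun_inv (hpos x hx).ne')
    (fun x hx ↦ div_nonpos_of_nonpos_of_nonneg (neg_nonpos.2 (hf'' x hx)) (sq_nonneg _))
    (inv_nonneg.2 (hpos b (right_mem_Icc.2 hab)).le)

theorem mul_sub_le_sub_of_le_deriv (hf' : ∀ x ∈ Icc a b, HasDerivAt f' (f'' x) x)
    (hf'' : ∀ x ∈ Icc a b, l ≤ f'' x) {x y : ℝ} (hx : x ∈ Icc a b) (hy : y ∈ Icc a b)
    (hxy : x ≤ y) : l * (y - x) ≤ f' y - f' x :=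
  (convex_Icc a b).mul_sub_le_image_sub_of_le_deriv
    (fun z hz ↦ (hf' z hz).continuousAt.continuousWithinAt)
    (fun z hz ↦ (hf' z (interior_subset hz)).differentiableAt.differentiableWithinAt)
    (fun z hz ↦ by rw [(hf' z (interior_subset hz)).deriv]; exact hf'' z (interior_subset hz))
    x hx y hy hxy

theorem norm_integral_cexp_le_of_le_deriv2_of_nonneg_left (hab : a ≤ b) (hl : 0 < l)
    (hf : ∀ x ∈ Icc a b, HasDerivAt f (f' x) x) (hf' : ∀ x ∈ Icc a b, HasDerivAt f' (f'' x) x)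
    (hf'' : ∀ x ∈ Icc a b, l ≤ f'' x) (ha : 0 ≤ f' a) :
    ‖∫ x in a..b, Complex.exp (f x * Complex.I)‖ ≤ 3 / √l := by
  have hs : 0 < √l := Real.sqrt_pos.2 hl
  rcases le_total b (a + 1 / √l) with hshort | hlong
  · calc _ ≤ b - a := norm_integral_cexp_le_length hab
      _ ≤ 1 / √l := by linarith
      _ ≤ 3 / √l := by gcongr; norm_num
  set c := a + 1 / √l with hc
  have hac : a ≤ c := le_add_of_nonneg_right (by positivity)
  have hcmem : c ∈ Icc a b := ⟨hac, hlong⟩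
  have hcb : Icc c b ⊆ Icc a b := Icc_subset_Icc_left hac
  have hf'c : √l ≤ f' c := by
    have := mul_sub_le_sub_of_le_deriv hf' hf'' (left_mem_Icc.2 hab) hcmem hac
    rw [hc, add_sub_cancel_left, mul_one_div, Real.div_sqrt] at this
    linarith
  have hi := continuousOn_cexp_mul_I hf
  rw [← intervalIntegral.integral_add_adjacent_intervals
    ((hi.mono (Icc_subset_Icc_right hlong)).intervalIntegrable_of_Icc hac)
    ((hi.mono hcb).intervalIntegrable_of_Icc hlong)]
  calc _ ≤ (c - a) + 2 / f' c := (norm_add_le _ _).trans <| add_le_add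
        (norm_integral_cexp_le_length hac)
        (norm_integral_cexp_le_two_div_deriv hlong (fun x hx ↦ hf x (hcb hx))
          (fun x hx ↦ hf' x (hcb hx)) (fun x hx ↦ hl.le.trans (hf'' x (hcb hx)))
          (hs.trans_le hf'c))
    _ ≤ 1 / √l + 2 / √l := by
        refine add_le_add (by rw [hc, add_sub_cancel_left]) ?_
        gcongr
    _ = 3 / √l := by ring

theorem norm_integral_cexp_le_of_le_deriv2_of_nonpos_right (hab : a ≤ b) (hl : 0 < l)
    (hf : ∀ x ∈ Icc a b, HasDerivAt f (f' x) x) (hf' : ∀ x ∈ Icc a b, HasDerivAt f' (f'' x) x)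
    (hf'' : ∀ x ∈ Icc a b, l ≤ f'' x) (hb : f' b ≤ 0) :
    ‖∫ x in a..b, Complex.exp (f x * Complex.I)‖ ≤ 3 / √l := by
  have hmem : ∀ x ∈ Icc (-b) (-a), -x ∈ Icc a b := fun x hx ↦
    ⟨le_neg_of_le_neg hx.2, neg_le_of_neg_le hx.1⟩
  have reflected := norm_integral_cexp_le_of_le_deriv2_of_nonneg_left
    (f := fun x ↦ f (-x)) (f' := fun x ↦ -f' (-x)) (f'' := fun x ↦ f'' (-x))
    (neg_le_neg hab) hl
    (fun x hx ↦ by simpa [Function.comp_def] using (hf _ (hmem x hx)).comp x (hasDerivAt_neg x))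
    (fun x hx ↦ by simpa [Function.comp_def] using
      ((hf' _ (hmem x hx)).comp x (hasDerivAt_neg x)).fun_neg)
    (fun x hx ↦ hf'' _ (hmem x hx)) (by simpa using hb)
  rwa [intervalIntegral.integral_comp_neg fun x ↦ Complex.exp (f x * Complex.I), neg_neg,
    neg_neg] at reflected

theorem norm_integral_cexp_le_of_le_deriv2 (hab : a ≤ b) (hl : 0 < l)
    (hf : ∀ x ∈ Icc a b, HasDerivAt f (f' x) x) (hf' : ∀ x ∈ Icc a b, HasDerivAt f' (f'' x) x)
    (hf'' : ∀ x ∈ Icc a b, l ≤ f'' x) :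
    ‖∫ x in a..b, Complex.exp (f x * Complex.I)‖ ≤ 6 / √l := by
  have h36 : 3 / √l ≤ 6 / √l := by gcongr; norm_num
  rcases le_total 0 (f' a) with ha | ha
  · exact (norm_integral_cexp_le_of_le_deriv2_of_nonneg_left hab hl hf hf' hf'' ha).trans h36
  rcases le_total (f' b) 0 with hb | hb
  · exact (norm_integral_cexp_le_of_le_deriv2_of_nonpos_right hab hl hf hf' hf'' hb).trans h36
  obtain ⟨z, hz, hz0⟩ := intermediate_value_Icc hab
    (fun x hx ↦ (hf' x hx).continuousAt.continuousWithinAt) ⟨ha, hb⟩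
  have hleft : Icc a z ⊆ Icc a b := Icc_subset_Icc_right hz.2
  have hright : Icc z b ⊆ Icc a b := Icc_subset_Icc_left hz.1
  have hi := continuousOn_cexp_mul_I hf
  rw [← intervalIntegral.integral_add_adjacent_intervals
    ((hi.mono hleft).intervalIntegrable_of_Icc hz.1)
    ((hi.mono hright).intervalIntegrable_of_Icc hz.2)]
  calc _ ≤ 3 / √l + 3 / √l := (norm_add_le _ _).trans <| add_le_add
        (norm_integral_cexp_le_of_le_deriv2_of_nonpos_right hz.1 hl (fun x hx ↦ hf x (hleft hx))
          (fun x hx ↦ hf' x (hleft hx)) (fun x hx ↦ hf'' x (hleft hx)) hz0.le)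
        (norm_integral_cexp_le_of_le_deriv2_of_nonneg_left hz.2 hl (fun x hx ↦ hf x (hright hx))
          (fun x hx ↦ hf' x (hright hx)) (fun x hx ↦ hf'' x (hright hx)) hz0.ge)
    _ = 6 / √l := by ring

theorem norm_integral_smul_cexp_le_of_le_deriv2 {w w' : ℝ → ℝ} (hab : a ≤ b) (hl : 0 < l)
    (hf : ∀ x ∈ Icc a b, HasDerivAt f (f' x) x) (hf' : ∀ x ∈ Icc a b, HasDerivAt f' (f'' x) x)
    (hf'' : (∀ x ∈ Icc a b, l ≤ f'' x) ∨ ∀ x ∈ Icc a b, l ≤ -f'' x)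
    (hw : ∀ x ∈ Icc a b, HasDerivAt w (w' x) x) (hw' : ∀ x ∈ Icc a b, w' x ≤ 0) (hwb : 0 ≤ w b) :
    ‖∫ x in a..b, w x • Complex.exp (f x * Complex.I)‖ ≤ 6 / √l * w a := by
  refine norm_integral_smul_le_of_deriv_nonpos hab (continuousOn_cexp_mul_I hf) (fun y hy ↦ ?_)
    hw hw' hwb
  have hsub : Icc a y ⊆ Icc a b := Icc_subset_Icc_right hy.2
  rcases hf'' with hconvex | hconcave
  · exact norm_integral_cexp_le_of_le_deriv2 hy.1 hl (fun x hx ↦ hf x (hsub hx))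
      (fun x hx ↦ hf' x (hsub hx)) fun x hx ↦ hconvex x (hsub hx)
  · rw [← norm_integral_cexp_neg]
    exact norm_integral_cexp_le_of_le_deriv2 hy.1 hl (fun x hx ↦ (hf x (hsub hx)).neg)
      (fun x hx ↦ (hf' x (hsub hx)).neg) fun x hx ↦ hconcave x (hsub hx)

end OscillatoryIntegrals

theorem hasDerivAt_phi (x : ℝ) : HasDerivAt phi ((1 - x ^ 2) / (1 + x ^ 2) ^ 2) x := by
  have h := (hasDerivAt_id x).fun_div ((hasDerivAt_pow 2 x).const_add 1)
    (by positivity : (1 : ℝ) + x ^ 2 ≠ 0)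
  exact h.congr_deriv (by simp only [id]; push_cast; ring)

theorem deriv_phi : deriv phi = fun x ↦ (1 - x ^ 2) / (1 + x ^ 2) ^ 2 :=
  funext fun x ↦ (hasDerivAt_phi x).deriv

theorem hasDerivAt_deriv_phi (x : ℝ) :
    HasDerivAt (deriv phi) (2 * x * (x ^ 2 - 3) / (1 + x ^ 2) ^ 3) x := by
  have hx : (1 : ℝ) + x ^ 2 ≠ 0 := by positivity
  have h := ((hasDerivAt_pow 2 x).const_sub 1).fun_div
    (((hasDerivAt_pow 2 x).const_add 1).fun_pow 2) (pow_ne_zero 2 hx)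
  rw [deriv_phi]
  refine h.congr_deriv ?_
  push_cast
  field_simp
  ring

theorem deriv_deriv_phi (x : ℝ) :
    deriv (deriv phi) x = 2 * x * (x ^ 2 - 3) / (1 + x ^ 2) ^ 3 :=
  (hasDerivAt_deriv_phi x).deriv

theorem continuous_phi : Continuous phi :=
  continuous_iff_continuousAt.2 fun x ↦ (hasDerivAt_phi x).continuousAt

theorem phi_neg (x : ℝ) : phi (-x) = -phi x := by
  simp only [phi, neg_sq, neg_div]

theorem le_neg_deriv_deriv_phi {d η : ℝ} (hd0 : 0 < d) (hd : d ≤ 1 / 2)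
    (hη : η ∈ Icc d (√3 - d)) : d / 128 ≤ -deriv (deriv phi) η := by
  have h3 : √3 * √3 = 3 := Real.mul_self_sqrt (by norm_num)
  have h3' : 1.7 ≤ √3 := Real.le_sqrt_of_sq_le (by norm_num)
  obtain ⟨hdη, hη3⟩ := hη
  have hη0 : 0 < η := hd0.trans_le hdη
  rw [deriv_deriv_phi, ← neg_div, le_div_iff₀ (by positivity)]
  have denominator : (1 + η ^ 2) ^ 3 ≤ 4 ^ 3 := pow_le_pow_left₀ (by positivity) (by nlinarith) 3
  have dist_zeros : d ≤ η * (√3 - η) := by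
    nlinarith [mul_nonneg (sub_nonneg.2 hdη) (sub_nonneg.2 hη3)]
  have factorization : -(2 * η * (η ^ 2 - 3)) = 2 * (η * (√3 - η)) * (√3 + η) := by
    linear_combination (-2 * η) * h3
  rw [factorization]
  nlinarith

theorem le_deriv_deriv_phi {d η : ℝ} (hd0 : 0 < d) (hη : η ∈ Icc (√3 + d) 3) :
    d / 128 ≤ deriv (deriv phi) η := by
  have h3 : √3 * √3 = 3 := Real.mul_self_sqrt (by norm_num)
  have h3' : 1.7 ≤ √3 := Real.le_sqrt_of_sq_le (by norm_num)
  obtain ⟨hdη, hη3⟩ := hη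
  have hη0 : 1.7 < η := by linarith
  rw [deriv_deriv_phi, le_div_iff₀ (by positivity)]
  have denominator : (1 + η ^ 2) ^ 3 ≤ 10 ^ 3 := pow_le_pow_left₀ (by positivity) (by nlinarith) 3
  have factorization : 2 * η * (η ^ 2 - 3) = (η - √3) * (2 * η * (√3 + η)) := by
    linear_combination (2 * η) * h3
  have cofactor : 8 ≤ 2 * η * (√3 + η) := by nlinarith
  rw [factorization]
  nlinarith

theorem div_pow_three_le_deriv_deriv_phi {N η : ℝ} (hη : η ∈ Icc 3 N) :
    27 / 64 / N ^ 3 ≤ deriv (deriv phi) η := by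
  obtain ⟨h3η, hηN⟩ := hη
  have hη0 : 0 < η := by linarith
  rw [deriv_deriv_phi]
  calc 27 / 64 / N ^ 3 ≤ 27 / 64 / η ^ 3 := by gcongr
    _ ≤ 2 * η * (2 / 3 * η ^ 2) / (10 / 9 * η ^ 2) ^ 3 := by
        rw [div_le_div_iff₀ (by positivity) (by positivity)]
        nlinarith [pow_pos hη0 6]
    _ ≤ 2 * η * (η ^ 2 - 3) / (1 + η ^ 2) ^ 3 := by
        gcongr <;> nlinarith

theorem hasDerivAt_one_add_sq_rpow (s x : ℝ) : HasDerivAt (fun x : ℝ ↦ (1 + x ^ 2) ^ s)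
    (2 * x * s * (1 + x ^ 2) ^ (s - 1)) x := by
  simpa using ((hasDerivAt_pow 2 x).const_add 1).rpow_const (p := s)
    (Or.inl (by positivity : (1 : ℝ) + x ^ 2 ≠ 0))

theorem continuous_one_add_sq_rpow (s : ℝ) : Continuous fun x : ℝ ↦ (1 + x ^ 2) ^ s :=
  continuous_iff_continuousAt.2 fun x ↦ (hasDerivAt_one_add_sq_rpow s x).continuousAt

theorem one_add_sq_rpow_le_one {s : ℝ} (hs : s ≤ 0) (x : ℝ) : (1 + x ^ 2) ^ s ≤ 1 :=
  Real.rpow_le_one_of_one_le_of_nonpos (le_add_of_nonneg_right (sq_nonneg x)) hs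

theorem integrable_one_add_sq_rpow {s : ℝ} (hs : s < -1) :
    Integrable fun x : ℝ ↦ (1 + x ^ 2) ^ (s / 2) := by
  simpa using integrable_rpow_neg_one_add_norm_sq (E := ℝ) (μ := volume) (r := -s)
    (by rw [Module.finrank_self]; push_cast; linarith)

section Kernel

variable {σ : ℝ}

/-- The integrand `(1 + η²)^{σ/2} e^{i(xη - tφ(η))}` whose integral over `η ∈ ℝ` is, up to the
factor `2π`, the convolution kernel of `J^σ S(t)` at `x`. -/
noncomputable def kernelIntegrand (σ x t η : ℝ) : ℂ :=
  (1 + η ^ 2) ^ (σ / 2) • Complex.exp ((x * η - t * phi η : ℝ) * Complex.I)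

theorem norm_kernelIntegrand (σ x t η : ℝ) :
    ‖kernelIntegrand σ x t η‖ = (1 + η ^ 2) ^ (σ / 2) := by
  rw [kernelIntegrand, norm_smul, Complex.norm_exp_ofReal_mul_I, mul_one,
    Real.norm_of_nonneg (by positivity)]

theorem kernelIntegrand_neg (σ x t η : ℝ) :
    kernelIntegrand σ x t (-η) = kernelIntegrand σ (-x) (-t) η := by
  simp only [kernelIntegrand, phi_neg, neg_sq, mul_neg, neg_mul]

theorem continuous_kernelIntegrand (σ x t : ℝ) : Continuous (kernelIntegrand σ x t) := by
  have := continuous_one_add_sq_rpow (σ / 2)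
  have := continuous_phi
  unfold kernelIntegrand
  fun_prop

theorem integrable_kernelIntegrand (hσ : σ < -1) (x t : ℝ) : Integrable (kernelIntegrand σ x t) :=
  (integrable_one_add_sq_rpow hσ).mono' (continuous_kernelIntegrand σ x t).aestronglyMeasurable
    (.of_forall fun η ↦ (norm_kernelIntegrand σ x t η).le)

theorem norm_integral_kernelIntegrand_le_length (hσ : σ ≤ 0) (x t : ℝ) {a b : ℝ} (hab : a ≤ b) :
    ‖∫ η in a..b, kernelIntegrand σ x t η‖ ≤ b - a := by
  have := intervalIntegral.norm_integral_le_of_norm_le_const (a := a) (b := b) (C := 1)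
    (f := kernelIntegrand σ x t) fun η _ ↦ by
      rw [norm_kernelIntegrand]; exact one_add_sq_rpow_le_one (by linarith) η
  rwa [one_mul, abs_of_nonneg (sub_nonneg.2 hab)] at this

theorem norm_integral_kernelIntegrand_le_of_le_deriv2 (hσ : σ ≤ 0) (x : ℝ) {t a b k : ℝ}
    (ht : t ≠ 0) (ha : 0 ≤ a) (hab : a ≤ b) (hk : 0 < k)
    (hphi : (∀ η ∈ Icc a b, k ≤ deriv (deriv phi) η) ∨
      ∀ η ∈ Icc a b, k ≤ -deriv (deriv phi) η) :
    ‖∫ η in a..b, kernelIntegrand σ x t η‖ ≤ 6 / √(|t| * k) := by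
  have ht' := abs_pos.2 ht
  have phase_convex_or_concave : (∀ η ∈ Icc a b, |t| * k ≤ -(t * deriv (deriv phi) η)) ∨
      ∀ η ∈ Icc a b, |t| * k ≤ - -(t * deriv (deriv phi) η) := by
    rcases abs_choice t with hsign | hsign <;> rcases hphi with h | h <;>
    [right; left; left; right] <;> intro η hη <;>
    have := mul_le_mul_of_nonneg_left (h η hη) ht'.le <;> rw [hsign] at this ⊢ <;> linarith
  have vanDerCorput := norm_integral_smul_cexp_le_of_le_deriv2
    (f := fun η ↦ x * η - t * phi η) (w := fun η ↦ (1 + η ^ 2) ^ (σ / 2)) hab (mul_pos ht' hk)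
    (fun η _ ↦ ((hasDerivAt_id' η).const_mul x).fun_sub ((hasDerivAt_phi η).const_mul t))
    (fun η _ ↦ by simpa only [deriv_phi, mul_one] using
      ((hasDerivAt_deriv_phi η).differentiableAt.hasDerivAt.const_mul t).const_sub x)
    phase_convex_or_concave (fun η _ ↦ hasDerivAt_one_add_sq_rpow _ η)
    (fun η hη ↦ mul_nonpos_of_nonpos_of_nonneg
      (mul_nonpos_of_nonneg_of_nonpos (mul_nonneg zero_le_two (ha.trans hη.1)) (by linarith))
      (by positivity)) (by positivity)
  exact vanDerCorput.trans
    (mul_le_of_le_one_right (by positivity) (one_add_sq_rpow_le_one (by linarith) a))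

theorem norm_integral_Ioi_kernelIntegrand_le (hσ : σ < -1) (x t : ℝ) {N : ℝ} (hN : 0 < N) :
    ‖∫ η in Ioi N, kernelIntegrand σ x t η‖ ≤ N ^ (σ + 1) / (-σ - 1) := by
  calc ‖∫ η in Ioi N, kernelIntegrand σ x t η‖ ≤ ∫ η in Ioi N, η ^ σ := by
        refine norm_integral_le_of_norm_le (integrableOn_Ioi_rpow_of_lt hσ hN) ?_
        filter_upwards [ae_restrict_mem measurableSet_Ioi] with η hη
        have hη0 : 0 < η := hN.trans hη
        rw [norm_kernelIntegrand]
        calc (1 + η ^ 2) ^ (σ / 2) ≤ (η ^ 2) ^ (σ / 2) :=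
              Real.rpow_le_rpow_of_nonpos (by positivity) (by linarith) (by linarith)
          _ = η ^ σ := by
              rw [← Real.rpow_natCast, ← Real.rpow_mul hη0.le]
              push_cast
              rw [mul_div_cancel₀ σ two_ne_zero]
    _ = N ^ (σ + 1) / (-σ - 1) := by
        rw [integral_Ioi_rpow_of_lt hσ hN, ← neg_div_neg_eq, neg_neg, neg_add']

theorem six_div_sqrt_mul_rpow_neg_third {T : ℝ} (hT : 0 < T) :
    6 / √(T * (T ^ (-1 / 3 : ℝ) / 2 / 128)) = 96 * T ^ (-1 / 3 : ℝ) := by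
  have hsq : T * (T ^ (-1 / 3 : ℝ) / 2 / 128) = (T ^ (1 / 3 : ℝ) / 16) ^ 2 := by
    have : T * T ^ (-1 / 3 : ℝ) = T ^ (1 / 3 : ℝ) * T ^ (1 / 3 : ℝ) := by
      rw [← Real.rpow_one_add' hT.le (by norm_num), ← Real.rpow_add hT]; norm_num
    linear_combination this / 256
  rw [hsq, Real.sqrt_sq (by positivity), neg_div, Real.rpow_neg hT.le]
  field_simp
  norm_num

theorem norm_integral_zero_three_kernelIntegrand_le (hσ : σ < -1) (x : ℝ) {t : ℝ} (ht : 1 ≤ |t|) :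
    ‖∫ η in (0)..3, kernelIntegrand σ x t η‖ ≤ 194 * |t| ^ (-1 / 3 : ℝ) := by
  set T := |t| with hT
  have hT0 : 0 < T := by linarith
  have ht0 : t ≠ 0 := abs_pos.1 hT0
  -- This `d` balances the lengths of the intervals around `0` and `√3` against `1 / √(T d)`.
  set d := T ^ (-1 / 3 : ℝ) / 2 with hd
  have hd0 : 0 < d := by positivity
  have hd1 : d ≤ 1 / 2 := by
    linarith [Real.rpow_le_one_of_one_le_of_nonpos ht (by norm_num : (-1 / 3 : ℝ) ≤ 0)]
  have h3 : 1.7 ≤ √3 := Real.le_sqrt_of_sq_le (by norm_num)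
  have h3' : √3 ≤ 1.8 := Real.sqrt_le_iff.2 (by norm_num)
  have oscillation : 6 / √(T * (d / 128)) = 96 * T ^ (-1 / 3 : ℝ) :=
    six_div_sqrt_mul_rpow_neg_third hT0
  have hi : ∀ u v, IntervalIntegrable (kernelIntegrand σ x t) volume u v := fun u v ↦
    (continuous_kernelIntegrand σ x t).intervalIntegrable u v
  have near_zero := norm_integral_kernelIntegrand_le_length (by linarith) x t hd0.le (σ := σ)
  have concave := norm_integral_kernelIntegrand_le_of_le_deriv2 (σ := σ) (by linarith) x ht0
    hd0.le (b := √3 - d) (by linarith) (by positivity : 0 < d / 128)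
    (Or.inr fun η hη ↦ le_neg_deriv_deriv_phi hd0 hd1 hη)
  have near_sqrt_three := norm_integral_kernelIntegrand_le_length (σ := σ) (by linarith) x t
    (a := √3 - d) (b := √3 + d) (by linarith)
  have convex := norm_integral_kernelIntegrand_le_of_le_deriv2 (σ := σ) (by linarith) x ht0
    (a := √3 + d) (b := 3) (by linarith) (by linarith) (by positivity : 0 < d / 128)
    (Or.inl fun η hη ↦ le_deriv_deriv_phi hd0 hη)
  rw [← hT, oscillation] at concave convex
  rw [← intervalIntegral.integral_add_adjacent_intervals (hi 0 d) (hi d 3),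
    ← intervalIntegral.integral_add_adjacent_intervals (hi d (√3 - d)) (hi (√3 - d) 3),
    ← intervalIntegral.integral_add_adjacent_intervals (hi (√3 - d) (√3 + d)) (hi (√3 + d) 3)]
  refine (norm_add_le_of_le near_zero (norm_add_le_of_le concave
    (norm_add_le_of_le near_sqrt_three convex))).trans ?_
  linarith [Real.rpow_pos_of_pos hT0 (-1 / 3)]

theorem six_div_sqrt_mul_div_pow_three {T : ℝ} (hT : 0 < T) (hσ : 1 - 2 * σ ≠ 0) :
    6 / √(T * (27 / 64 / (3 * T ^ (1 / (1 - 2 * σ))) ^ 3)) = 48 * T ^ ((σ + 1) / (1 - 2 * σ)) := by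
  have hcube : (T ^ (1 / (1 - 2 * σ))) ^ 3 = (T ^ ((σ + 1) / (1 - 2 * σ))) ^ 2 * T := by
    rw [← Real.rpow_mul_natCast hT.le, ← Real.rpow_mul_natCast hT.le, ← Real.rpow_add_one hT.ne']
    congr 1
    push_cast
    field_simp
    ring
  have hsq : T * (27 / 64 / (3 * T ^ (1 / (1 - 2 * σ))) ^ 3) =
      ((T ^ ((σ + 1) / (1 - 2 * σ)))⁻¹ / 8) ^ 2 := by
    rw [mul_pow, hcube]
    field_simp
    norm_num
  rw [hsq, Real.sqrt_sq (by positivity)]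
  field_simp
  norm_num

theorem norm_integral_Ioi_three_kernelIntegrand_le (hσ : σ < -1) (x : ℝ) {t : ℝ} (ht : 1 ≤ |t|) :
    ‖∫ η in Ioi 3, kernelIntegrand σ x t η‖ ≤
      (48 + 1 / (-σ - 1)) * |t| ^ ((σ + 1) / (1 - 2 * σ)) := by
  set T := |t| with hT
  have hT0 : 0 < T := by linarith
  have h12 : 1 - 2 * σ ≠ 0 := by linarith
  -- This `N` balances `1 / √(T / N ^ 3)` against the tail `N ^ (σ + 1)`.
  set N := 3 * T ^ (1 / (1 - 2 * σ))
  have hN0 : 0 < N := by positivity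
  have hN3 : 3 ≤ N := by
    linarith [Real.one_le_rpow ht (one_div_nonneg.2 (by linarith : 0 ≤ 1 - 2 * σ))]
  have oscillation : 6 / √(T * (27 / 64 / N ^ 3)) = 48 * T ^ ((σ + 1) / (1 - 2 * σ)) :=
    six_div_sqrt_mul_div_pow_three hT0 h12
  have middle := norm_integral_kernelIntegrand_le_of_le_deriv2 (σ := σ) (by linarith) x
    (abs_pos.1 hT0) (a := 3) (b := N) (by norm_num) hN3 (by positivity)
    (Or.inl fun η hη ↦ div_pow_three_le_deriv_deriv_phi hη)
  have tail : ‖∫ η in Ioi N, kernelIntegrand σ x t η‖ ≤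
      1 / (-σ - 1) * T ^ ((σ + 1) / (1 - 2 * σ)) := calc
    _ ≤ N ^ (σ + 1) / (-σ - 1) := norm_integral_Ioi_kernelIntegrand_le hσ x t hN0
    _ ≤ (T ^ (1 / (1 - 2 * σ))) ^ (σ + 1) / (-σ - 1) := by
        refine div_le_div_of_nonneg_right ?_ (by linarith)
        refine Real.rpow_le_rpow_of_nonpos (by positivity) ?_ (by linarith)
        linarith [Real.rpow_pos_of_pos hT0 (1 / (1 - 2 * σ))]
    _ = 1 / (-σ - 1) * T ^ ((σ + 1) / (1 - 2 * σ)) := by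
        rw [← Real.rpow_mul hT0.le, one_div_mul_eq_div, div_eq_inv_mul, one_div]
  rw [← hT, oscillation] at middle
  have hI := integrable_kernelIntegrand hσ x t
  rw [← intervalIntegral.integral_interval_add_Ioi' hI.intervalIntegrable hI.integrableOn (b := N)]
  linarith [norm_add_le_of_le middle tail]

/-- The exponent of `|t|` in the decay of the kernel of `J^σ S(t)`: `-1/3` is contributed by the
inflection points `0`, `±√3` of `φ`, and `(σ + 1) / (1 - 2σ)` by the high frequencies. -/
noncomputable def decayRate (σ : ℝ) : ℝ := max (-1 / 3) ((σ + 1) / (1 - 2 * σ))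

theorem norm_integral_Ioi_zero_kernelIntegrand_le (hσ : σ < -1) (x : ℝ) {t : ℝ} (ht : 1 ≤ |t|) :
    ‖∫ η in Ioi 0, kernelIntegrand σ x t η‖ ≤ (242 + 1 / (-σ - 1)) * |t| ^ decayRate σ := by
  have hI := integrable_kernelIntegrand hσ x t
  have hs : 0 ≤ 1 / (-σ - 1) := one_div_nonneg.2 (by linarith)
  rw [← intervalIntegral.integral_interval_add_Ioi' hI.intervalIntegrable hI.integrableOn (b := 3)]
  calc _ ≤ 194 * |t| ^ (-1 / 3 : ℝ) + (48 + 1 / (-σ - 1)) * |t| ^ ((σ + 1) / (1 - 2 * σ)) :=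
        norm_add_le_of_le (norm_integral_zero_three_kernelIntegrand_le hσ x ht)
          (norm_integral_Ioi_three_kernelIntegrand_le hσ x ht)
    _ ≤ 194 * |t| ^ decayRate σ + (48 + 1 / (-σ - 1)) * |t| ^ decayRate σ := by
        gcongr
        exacts [le_max_left _ _, le_max_right _ _]
    _ = (242 + 1 / (-σ - 1)) * |t| ^ decayRate σ := by ring

theorem exists_norm_integral_kernelIntegrand_le (hσ : σ < -1) :
    ∃ C : ℝ, ∀ x t : ℝ, ‖∫ η, kernelIntegrand σ x t η‖ ≤ C * max 1 |t| ^ decayRate σ := by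
  set W := ∫ η : ℝ, (1 + η ^ 2) ^ (σ / 2)
  have hW : 0 ≤ W := integral_nonneg fun η ↦ by positivity
  have hs : 0 < 1 / (-σ - 1) := one_div_pos.2 (by linarith)
  refine ⟨2 * (242 + 1 / (-σ - 1)) + W, fun x t ↦ ?_⟩
  rcases le_total 1 |t| with ht | ht
  · have hI := integrable_kernelIntegrand hσ x t
    have reflection : ∫ η in Iic 0, kernelIntegrand σ x t η =
        ∫ η in Ioi 0, kernelIntegrand σ (-x) (-t) η := by
      simp_rw [← kernelIntegrand_neg, integral_comp_neg_Ioi, neg_zero]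
    rw [max_eq_right ht, ← intervalIntegral.integral_Iic_add_Ioi hI.integrableOn hI.integrableOn,
      reflection]
    have negative := norm_integral_Ioi_zero_kernelIntegrand_le hσ (-x) (t := -t) (by rwa [abs_neg])
    have positive := norm_integral_Ioi_zero_kernelIntegrand_le hσ x ht
    rw [abs_neg] at negative
    nlinarith [norm_add_le_of_le negative positive,
      mul_nonneg hW (by positivity : 0 ≤ |t| ^ decayRate σ)]
  · rw [max_eq_left ht, Real.one_rpow, mul_one]
    calc ‖∫ η, kernelIntegrand σ x t η‖ ≤ ∫ η, ‖kernelIntegrand σ x t η‖ :=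
          norm_integral_le_integral_norm _
      _ = W := by simp_rw [norm_kernelIntegrand]; rfl
      _ ≤ _ := le_add_of_nonneg_left (by positivity)

end Kernel

section RieszThorin

open Filter
open scoped Topology

variable {α : Type*} [MeasurableSpace α] {μ : Measure α}

/-- The entire family `z ↦ (c / |c|) |c| ^ ((1 - z) a + z b)`, vanishing at `c = 0`. It passes
through `c` where the exponent equals `1`, and its modulus depends on `Re z` only; applied to the
values of a function, it is the family that Riesz–Thorin interpolation feeds to the three lines
theorem. -/
noncomputable def powerFamily (a b : ℝ) (z c : ℂ) : ℂ :=
  c / ‖c‖ * (‖c‖ : ℂ) ^ ((1 - z) * a + z * b)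

section PowerFamily

variable (a b : ℝ)

theorem powerFamily_zero (z : ℂ) : powerFamily a b z 0 = 0 := by simp [powerFamily]

variable {a b}

theorem powerFamily_eq_self {θ : ℝ} (h : (1 - θ) * a + θ * b = 1) (c : ℂ) :
    powerFamily a b θ c = c := by
  rcases eq_or_ne c 0 with rfl | hc
  · exact powerFamily_zero a b θ
  · have h_exp : (1 - (θ : ℂ)) * a + θ * b = 1 := by exact_mod_cast h
    rw [powerFamily, h_exp, Complex.cpow_one, div_mul_cancel₀ _ (by simpa using hc)]

theorem norm_powerFamily (z : ℂ) {c : ℂ} (hc : c ≠ 0) :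
    ‖powerFamily a b z c‖ = ‖c‖ ^ ((1 - z.re) * a + z.re * b) := by
  have h : 0 < ‖c‖ := norm_pos_iff.2 hc
  rw [powerFamily, norm_mul, norm_div, Complex.norm_real, norm_norm, div_self h.ne', one_mul,
    Complex.norm_cpow_eq_rpow_re_of_pos h]
  simp

theorem norm_powerFamily_le_rpow (z c : ℂ) :
    ‖powerFamily a b z c‖ ≤ ‖c‖ ^ ((1 - z.re) * a + z.re * b) := by
  rcases eq_or_ne c 0 with rfl | hc
  · rw [powerFamily_zero, norm_zero]
    positivity
  · exact (norm_powerFamily z hc).le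

theorem norm_powerFamily_le (ha : 0 ≤ a) (hb : 0 ≤ b) {z : ℂ} (hz₀ : 0 ≤ z.re) (hz₁ : z.re ≤ 1)
    (c : ℂ) : ‖powerFamily a b z c‖ ≤ (1 + ‖c‖) ^ (a + b) := by
  have hc : 0 ≤ ‖c‖ := norm_nonneg c
  calc ‖powerFamily a b z c‖ ≤ ‖c‖ ^ ((1 - z.re) * a + z.re * b) := norm_powerFamily_le_rpow z c
    _ ≤ (1 + ‖c‖) ^ ((1 - z.re) * a + z.re * b) := by
        have : 0 ≤ 1 - z.re := by linarith
        gcongr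
        linarith
    _ ≤ (1 + ‖c‖) ^ (a + b) :=
        Real.rpow_le_rpow_of_exponent_le (by linarith) (by nlinarith)

theorem differentiable_powerFamily (a b : ℝ) (c : ℂ) :
    Differentiable ℂ fun z ↦ powerFamily a b z c := by
  rcases eq_or_ne c 0 with rfl | hc
  · simp only [powerFamily_zero]
    exact differentiable_const 0
  · have h : (‖c‖ : ℂ) ≠ 0 := by simpa using hc
    exact (differentiable_const _).mul fun z ↦
      DifferentiableAt.const_cpow (by fun_prop) (Or.inl h)

end PowerFamily

theorem memLp_of_finMeasSupp {E : Type*} [NormedAddCommGroup E] {f : SimpleFunc α E}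
    (hf : f.FinMeasSupp μ) (p : ℝ≥0∞) : MemLp f p μ :=
  SimpleFunc.memLp_of_finite_measure_preimage p (SimpleFunc.finMeasSupp_iff.1 hf)

theorem exists_toLp_map_eq_sum {f : SimpleFunc α ℂ} (hf : f.FinMeasSupp μ) (r : ℝ≥0∞) :
    ∃ e : ℂ → Lp ℂ r μ, ∀ (h : ℂ → ℂ) (h0 : h 0 = 0),
      (memLp_of_finMeasSupp (hf.map h0) r).toLp (f.map h) = ∑ c ∈ f.range, h c • e c := by
  classical
  have hχ (c : ℂ) : Set.indicator ({c} \ {0}) 1 (0 : ℂ) = (0 : ℂ) := by simp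
  refine ⟨fun c ↦ (memLp_of_finMeasSupp (hf.map (hχ c)) r).toLp _, fun h h0 ↦ ?_⟩
  have h_coe : ∀ᵐ x ∂μ, ∀ c ∈ f.range,
      (h c • (memLp_of_finMeasSupp (hf.map (hχ c)) r).toLp _ : Lp ℂ r μ) x =
        h c * Set.indicator ({c} \ {0}) 1 (f x) := by
    refine (Finset.eventually_all _).2 fun c _ ↦ ?_
    filter_upwards [Lp.coeFn_smul (h c) ((memLp_of_finMeasSupp (hf.map (hχ c)) r).toLp _),
      (memLp_of_finMeasSupp (hf.map (hχ c)) r).coeFn_toLp] with x hx_smul hx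
    rw [hx_smul, Pi.smul_apply, hx, SimpleFunc.map_apply, smul_eq_mul]
  refine Lp.ext ?_
  filter_upwards [MemLp.coeFn_toLp (memLp_of_finMeasSupp (hf.map h0) r), h_coe,
    Lp.coeFn_finsetSum f.range fun c ↦
      h c • (memLp_of_finMeasSupp (hf.map (hχ c)) r).toLp _] with x hx hx_coe hx_sum
  rw [hx, hx_sum, Finset.sum_apply, Finset.sum_congr rfl hx_coe,
    Finset.sum_eq_single_of_mem (f x) (f.mem_range_self x)]
  · by_cases hfx : f x = 0 <;> simp [hfx, h0]
  · intro c _ hc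
    simp [hc.symm]

theorem eLpNorm_le_rpow_of_norm_le_rpow {E F : Type*} [NormedAddCommGroup E]
    [NormedAddCommGroup F] {u : α → E} {v : α → F} {p p₀ : ℝ≥0∞} (hp : p ≠ 0) (hp_top : p ≠ ∞)
    (h : ∀ x, ‖v x‖ ≤ ‖u x‖ ^ (p.toReal / p₀.toReal)) :
    eLpNorm v p₀ μ ≤ eLpNorm u p μ ^ (p.toReal / p₀.toReal) := by
  rcases eq_or_ne p₀ 0 with rfl | hp₀
  · simp
  rcases eq_or_ne p₀ ∞ with rfl | hp₀_top
  · simp only [ENNReal.toReal_top, div_zero, Real.rpow_zero] at h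
    simpa using eLpNormEssSup_le_of_ae_bound (μ := μ) (ae_of_all _ h)
  · have hr : 0 < p.toReal / p₀.toReal :=
      div_pos (ENNReal.toReal_pos hp hp_top) (ENNReal.toReal_pos hp₀ hp₀_top)
    have hp_eq : p₀ * ENNReal.ofReal (p.toReal / p₀.toReal) = p := by
      rw [ENNReal.ofReal_div_of_pos (ENNReal.toReal_pos hp₀ hp₀_top), ENNReal.ofReal_toReal hp_top,
        ENNReal.ofReal_toReal hp₀_top, ENNReal.mul_div_cancel hp₀ hp₀_top]
    calc eLpNorm v p₀ μ ≤ eLpNorm (fun x ↦ ‖u x‖ ^ (p.toReal / p₀.toReal)) p₀ μ :=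
          eLpNorm_mono_real h
      _ = eLpNorm u p μ ^ (p.toReal / p₀.toReal) := by rw [eLpNorm_norm_rpow u hr, hp_eq]

/-- The function `powerFamily a b z ∘ f` in `L^r`, for a simple function `f`. -/
noncomputable def powerFamilyLp (r : ℝ≥0∞) (a b : ℝ) {f : SimpleFunc α ℂ} (hf : f.FinMeasSupp μ)
    (z : ℂ) : Lp ℂ r μ :=
  (memLp_of_finMeasSupp (hf.map (powerFamily_zero a b z)) r).toLp _

theorem powerFamilyLp_eq_toLp {r : ℝ≥0∞} {a b : ℝ} {f : SimpleFunc α ℂ} (hf : f.FinMeasSupp μ)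
    {θ : ℝ} (h : (1 - θ) * a + θ * b = 1) :
    powerFamilyLp r a b hf θ = (memLp_of_finMeasSupp hf r).toLp f :=
  MemLp.toLp_congr _ _ (ae_of_all _ fun x ↦ powerFamily_eq_self h (f x))

variable {r s : ℝ≥0∞} [Fact (1 ≤ r)] [Fact (1 ≤ s)]

section PowerFamilyLp

variable {a b : ℝ} {f : SimpleFunc α ℂ}

theorem differentiable_powerFamilyLp (hf : f.FinMeasSupp μ) :
    Differentiable ℂ (powerFamilyLp r a b hf) := by
  obtain ⟨e, he⟩ := exists_toLp_map_eq_sum hf r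
  have h_sum : powerFamilyLp r a b hf = fun z ↦ ∑ c ∈ f.range, powerFamily a b z c • e c :=
    funext fun z ↦ he _ (powerFamily_zero a b z)
  rw [h_sum]
  exact Differentiable.fun_sum fun c _ ↦ (differentiable_powerFamily a b c).smul_const (e c)

theorem exists_norm_powerFamilyLp_le (hf : f.FinMeasSupp μ) (ha : 0 ≤ a) (hb : 0 ≤ b) :
    ∃ M : ℝ, ∀ z : ℂ, 0 ≤ z.re → z.re ≤ 1 → ‖powerFamilyLp r a b hf z‖ ≤ M := by
  obtain ⟨e, he⟩ := exists_toLp_map_eq_sum hf r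
  refine ⟨∑ c ∈ f.range, (1 + ‖c‖) ^ (a + b) * ‖e c‖, fun z hz₀ hz₁ ↦ ?_⟩
  rw [powerFamilyLp, he _ (powerFamily_zero a b z)]
  refine norm_sum_le_of_le _ fun c _ ↦ ?_
  rw [norm_smul]
  gcongr
  exact norm_powerFamily_le ha hb hz₀ hz₁ c

theorem toReal_eLpNorm_powerFamily_le (hf : f.FinMeasSupp μ) {p p₀ : ℝ≥0∞} (hp : p ≠ 0)
    (hp_top : p ≠ ∞) {z : ℂ}
    (hz : (1 - z.re) * a + z.re * b = p.toReal / p₀.toReal) :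
    (eLpNorm (f.map (powerFamily a b z)) p₀ μ).toReal ≤
      (eLpNorm f p μ).toReal ^ (p.toReal / p₀.toReal) := by
  rw [ENNReal.toReal_rpow]
  refine ENNReal.toReal_mono (ENNReal.rpow_ne_top_of_nonneg (by positivity)
    (memLp_of_finMeasSupp hf p).2.ne) (eLpNorm_le_rpow_of_norm_le_rpow hp hp_top fun x ↦ ?_)
  rw [← hz]
  exact norm_powerFamily_le_rpow z (f x)

end PowerFamilyLp

theorem exists_simpleFunc_tendsto {p : ℝ≥0∞} (hr : r ≠ ∞) (hp : 1 ≤ p) (hp_top : p ≠ ∞)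
    (f : Lp ℂ r μ) (hfp : MemLp f p μ) :
    ∃ (u : ℕ → SimpleFunc α ℂ) (hu : ∀ n, (u n).FinMeasSupp μ),
      Tendsto (fun n ↦ (memLp_of_finMeasSupp (hu n) r).toLp (u n)) atTop (𝓝 f) ∧
      Tendsto (fun n ↦ (eLpNorm (u n) p μ).toReal) atTop (𝓝 (eLpNorm f p μ).toReal) := by
  have : Fact (1 ≤ p) := ⟨hp⟩
  have hp0 : p ≠ 0 := (zero_lt_one.trans_le hp).ne'
  have hf_meas : Measurable f := (Lp.stronglyMeasurable f).measurable
  refine ⟨SimpleFunc.approxOn f hf_meas (Set.range f ∪ {0}) 0 (by simp), fun n ↦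
    (SimpleFunc.memLp_iff_finMeasSupp hp0 hp_top).1
      (SimpleFunc.memLp_approxOn_range hf_meas hfp n), ?_, ?_⟩
  · simpa only [Lp.toLp_coeFn] using SimpleFunc.tendsto_approxOn_range_Lp hr hf_meas (Lp.memLp f)
  · simpa only [Lp.norm_toLp] using (SimpleFunc.tendsto_approxOn_range_Lp hp_top hf_meas hfp).norm

theorem one_sub_mul_div_add_mul_div_eq_one {x x₀ x₁ θ : ℝ} (hx : x ≠ 0)
    (h : x⁻¹ = (1 - θ) * x₀⁻¹ + θ * x₁⁻¹) : (1 - θ) * (x / x₀) + θ * (x / x₁) = 1 := by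
  calc (1 - θ) * (x / x₀) + θ * (x / x₁) = x * ((1 - θ) * x₀⁻¹ + θ * x₁⁻¹) := by ring
    _ = 1 := by rw [← h, mul_inv_cancel₀ hx]

theorem rpow_mul_rpow_eq_self {M a b θ : ℝ} (hM : 0 ≤ M) (h : (1 - θ) * a + θ * b = 1) :
    (M ^ a) ^ (1 - θ) * (M ^ b) ^ θ = M := by
  rw [← Real.rpow_mul hM, ← Real.rpow_mul hM, mul_comm a, mul_comm b,
    ← Real.rpow_add' hM (h.trans_ne one_ne_zero), h, Real.rpow_one]

theorem rpow_interp_eq {A₀ A₁ M N a b c d θ : ℝ} (hA₀ : 0 ≤ A₀) (hA₁ : 0 ≤ A₁) (hM : 0 ≤ M)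
    (hN : 0 ≤ N) (hab : (1 - θ) * a + θ * b = 1) (hcd : (1 - θ) * c + θ * d = 1) :
    (A₀ * (M ^ a * N ^ c)) ^ (1 - θ) * (A₁ * (M ^ b * N ^ d)) ^ θ =
      A₀ ^ (1 - θ) * A₁ ^ θ * (M * N) := by
  nth_rw 3 [← rpow_mul_rpow_eq_self hM hab, ← rpow_mul_rpow_eq_self hN hcd]
  rw [Real.mul_rpow hA₀ (by positivity), Real.mul_rpow hA₁ (by positivity),
    Real.mul_rpow (by positivity) (by positivity), Real.mul_rpow (by positivity) (by positivity)]
  ring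

/-- The bilinear form `B`, given on `L^r × L^s`, is bounded by `A` for the norms of `L^p × L^q`. -/
def IsBoundedFor (B : Lp ℂ r μ →L[ℂ] Lp ℂ s μ →L[ℂ] ℂ) (p q : ℝ≥0∞) (A : ℝ) : Prop :=
  ∀ (f : Lp ℂ r μ) (g : Lp ℂ s μ), MemLp f p μ → MemLp g q μ →
    ‖B f g‖ ≤ A * ((eLpNorm f p μ).toReal * (eLpNorm g q μ).toReal)

namespace IsBoundedFor

variable {B : Lp ℂ r μ →L[ℂ] Lp ℂ s μ →L[ℂ] ℂ} {p q p₀ q₀ p₁ q₁ : ℝ≥0∞} {A A₀ A₁ θ : ℝ}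

theorem norm_apply_toLp_le (hB : IsBoundedFor B p q A) {f g : α → ℂ} (hf : MemLp f r μ)
    (hg : MemLp g s μ) (hfp : MemLp f p μ) (hgq : MemLp g q μ) :
    ‖B (hf.toLp f) (hg.toLp g)‖ ≤ A * ((eLpNorm f p μ).toReal * (eLpNorm g q μ).toReal) := by
  have h := hB (hf.toLp f) (hg.toLp g) ((memLp_congr_ae hf.coeFn_toLp).2 hfp)
    ((memLp_congr_ae hg.coeFn_toLp).2 hgq)
  rwa [eLpNorm_congr_ae hf.coeFn_toLp, eLpNorm_congr_ae hg.coeFn_toLp] at h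

theorem norm_apply_powerFamilyLp_le (hB : IsBoundedFor B p₀ q₀ A) (hA : 0 ≤ A) (hp : p ≠ 0)
    (hp_top : p ≠ ∞) (hq : q ≠ 0) (hq_top : q ≠ ∞) {f g : SimpleFunc α ℂ} (hf : f.FinMeasSupp μ)
    (hg : g.FinMeasSupp μ) {a b c d : ℝ} {z : ℂ}
    (hzp : (1 - z.re) * a + z.re * b = p.toReal / p₀.toReal)
    (hzq : (1 - z.re) * c + z.re * d = q.toReal / q₀.toReal) :
    ‖B (powerFamilyLp r a b hf z) (powerFamilyLp s c d hg z)‖ ≤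
      A * ((eLpNorm f p μ).toReal ^ (p.toReal / p₀.toReal) *
        (eLpNorm g q μ).toReal ^ (q.toReal / q₀.toReal)) := by
  refine (hB.norm_apply_toLp_le _ _
    (memLp_of_finMeasSupp (hf.map (powerFamily_zero a b z)) p₀)
    (memLp_of_finMeasSupp (hg.map (powerFamily_zero c d z)) q₀)).trans ?_
  gcongr
  · exact toReal_eLpNorm_powerFamily_le hf hp hp_top hzp
  · exact toReal_eLpNorm_powerFamily_le hg hq hq_top hzq

theorem norm_apply_simpleFunc_le (h₀ : IsBoundedFor B p₀ q₀ A₀) (h₁ : IsBoundedFor B p₁ q₁ A₁)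
    (hA₀ : 0 ≤ A₀) (hA₁ : 0 ≤ A₁) (hθ₀ : 0 ≤ θ) (hθ₁ : θ ≤ 1) (hp : p ≠ 0) (hp_top : p ≠ ∞)
    (hq : q ≠ 0) (hq_top : q ≠ ∞)
    (hpθ : p.toReal⁻¹ = (1 - θ) * p₀.toReal⁻¹ + θ * p₁.toReal⁻¹)
    (hqθ : q.toReal⁻¹ = (1 - θ) * q₀.toReal⁻¹ + θ * q₁.toReal⁻¹)
    {f g : SimpleFunc α ℂ} (hf : f.FinMeasSupp μ) (hg : g.FinMeasSupp μ) :
    ‖B ((memLp_of_finMeasSupp hf r).toLp f) ((memLp_of_finMeasSupp hg s).toLp g)‖ ≤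
      A₀ ^ (1 - θ) * A₁ ^ θ * ((eLpNorm f p μ).toReal * (eLpNorm g q μ).toReal) := by
  have hpab := one_sub_mul_div_add_mul_div_eq_one (ENNReal.toReal_pos hp hp_top).ne' hpθ
  have hqcd := one_sub_mul_div_add_mul_div_eq_one (ENNReal.toReal_pos hq hq_top).ne' hqθ
  set F : ℂ → ℂ := fun z ↦
    B (powerFamilyLp r (p.toReal / p₀.toReal) (p.toReal / p₁.toReal) hf z)
      (powerFamilyLp s (q.toReal / q₀.toReal) (q.toReal / q₁.toReal) hg z) with hF
  have hF_diff : Differentiable ℂ F :=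
    (B.differentiable.comp (differentiable_powerFamilyLp hf)).clm_apply
      (differentiable_powerFamilyLp hg)
  have hF_bdd : BddAbove ((norm ∘ F) '' Complex.HadamardThreeLines.verticalClosedStrip 0 1) := by
    obtain ⟨M, hM⟩ := exists_norm_powerFamilyLp_le (r := r) (a := p.toReal / p₀.toReal)
      (b := p.toReal / p₁.toReal) hf (by positivity) (by positivity)
    obtain ⟨N, hN⟩ := exists_norm_powerFamilyLp_le (r := s) (a := q.toReal / q₀.toReal)
      (b := q.toReal / q₁.toReal) hg (by positivity) (by positivity)
    refine ⟨‖B‖ * M * N, ?_⟩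
    rintro _ ⟨z, ⟨hz₀, hz₁⟩, rfl⟩
    exact B.le_of_opNorm₂_le_of_le le_rfl (hM z hz₀ hz₁) (hN z hz₀ hz₁)
  have h_interp := Complex.HadamardThreeLines.norm_le_interp_of_mem_verticalClosedStrip₀₁' F
    (z := (θ : ℂ)) ⟨by simpa using hθ₀, by simpa using hθ₁⟩ hF_diff.diffContOnCl hF_bdd
    (fun z (hz : z.re = 0) ↦ h₀.norm_apply_powerFamilyLp_le hA₀ hp hp_top hq hq_top hf hg
      (by rw [hz]; ring) (by rw [hz]; ring))
    (fun z (hz : z.re = 1) ↦ h₁.norm_apply_powerFamilyLp_le hA₁ hp hp_top hq hq_top hf hg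
      (by rw [hz]; ring) (by rw [hz]; ring))
  simp only [hF] at h_interp
  rw [powerFamilyLp_eq_toLp hf hpab, powerFamilyLp_eq_toLp hg hqcd, Complex.ofReal_re]
    at h_interp
  exact h_interp.trans_eq (rpow_interp_eq hA₀ hA₁ ENNReal.toReal_nonneg ENNReal.toReal_nonneg
    hpab hqcd)

theorem interp (h₀ : IsBoundedFor B p₀ q₀ A₀) (h₁ : IsBoundedFor B p₁ q₁ A₁)
    (hr : r ≠ ∞) (hs : s ≠ ∞) (hA₀ : 0 ≤ A₀) (hA₁ : 0 ≤ A₁) (hθ₀ : 0 ≤ θ) (hθ₁ : θ ≤ 1)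
    (hp : 1 ≤ p) (hp_top : p ≠ ∞) (hq : 1 ≤ q) (hq_top : q ≠ ∞)
    (hpθ : p.toReal⁻¹ = (1 - θ) * p₀.toReal⁻¹ + θ * p₁.toReal⁻¹)
    (hqθ : q.toReal⁻¹ = (1 - θ) * q₀.toReal⁻¹ + θ * q₁.toReal⁻¹) :
    IsBoundedFor B p q (A₀ ^ (1 - θ) * A₁ ^ θ) := by
  intro f g hfp hgq
  have hp0 : p ≠ 0 := (zero_lt_one.trans_le hp).ne'
  have hq0 : q ≠ 0 := (zero_lt_one.trans_le hq).ne'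
  obtain ⟨u, hu, hur, hup⟩ := exists_simpleFunc_tendsto hr hp hp_top f hfp
  obtain ⟨v, hv, hvs, hvq⟩ := exists_simpleFunc_tendsto hs hq hq_top g hgq
  have h_lim : Tendsto (fun n ↦ B ((memLp_of_finMeasSupp (hu n) r).toLp (u n))
      ((memLp_of_finMeasSupp (hv n) s).toLp (v n))) atTop (𝓝 (B f g)) :=
    (B.continuous₂.tendsto (f, g)).comp (hur.prodMk_nhds hvs)
  exact le_of_tendsto_of_tendsto' h_lim.norm ((hup.mul hvq).const_mul _) fun n ↦
    norm_apply_simpleFunc_le h₀ h₁ hA₀ hA₁ hθ₀ hθ₁ hp0 hp_top hq0 hq_top hpθ hqθ (hu n) (hv n)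

end IsBoundedFor

end RieszThorin

section Duality

variable {α : Type*} {r : ℝ} {h : α → ℂ}

/-- The extremizer of Hölder's inequality for `h`: the function whose product with `h` is `|h|^r`
and whose modulus is `|h|^(r-1)`. -/
noncomputable def dualFunction (r : ℝ) (h : α → ℂ) (x : α) : ℂ :=
  starRingEnd ℂ (h x) * (‖h x‖ ^ (r - 2) : ℝ)

theorem norm_dualFunction (hr : r ≠ 1) (x : α) : ‖dualFunction r h x‖ = ‖h x‖ ^ (r - 1) := by
  have h_exp : 1 + (r - 2) = r - 1 := by ring
  rw [dualFunction, norm_mul, RCLike.norm_conj, Complex.norm_real,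
    Real.norm_of_nonneg (by positivity),
    ← Real.rpow_one_add' (norm_nonneg _) (h_exp.trans_ne (sub_ne_zero.2 hr)), h_exp]

theorem mul_dualFunction (hr : r ≠ 0) (x : α) : h x * dualFunction r h x = (‖h x‖ ^ r : ℝ) := by
  rw [dualFunction, ← mul_assoc, Complex.mul_conj, Complex.normSq_eq_norm_sq,
    ← Complex.ofReal_mul, ← Real.rpow_natCast,
    ← Real.rpow_add' (norm_nonneg _) (by simpa using hr), Nat.cast_ofNat, add_sub_cancel]

variable [MeasurableSpace α] {μ : Measure α}

theorem aestronglyMeasurable_dualFunction (hh : AEStronglyMeasurable h μ) :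
    AEStronglyMeasurable (dualFunction r h) μ :=
  (Complex.continuous_conj.comp_aestronglyMeasurable hh).mul
    (Complex.continuous_ofReal.comp_aestronglyMeasurable
      (hh.norm.aemeasurable.pow_const _).aestronglyMeasurable)

theorem eLpNorm_dualFunction (hr : 1 < r) (q : ℝ≥0∞) :
    eLpNorm (dualFunction r h) q μ = eLpNorm h (q * ENNReal.ofReal (r - 1)) μ ^ (r - 1) := by
  rw [← eLpNorm_norm_rpow h (by linarith), ← eLpNorm_norm]
  simp only [norm_dualFunction hr.ne']

theorem memLp_dualFunction (hr : 1 < r) {q : ℝ≥0∞} (hh : MemLp h (q * ENNReal.ofReal (r - 1)) μ) :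
    MemLp (dualFunction r h) q μ := by
  refine ⟨aestronglyMeasurable_dualFunction hh.1, ?_⟩
  rw [eLpNorm_dualFunction hr]
  exact ENNReal.rpow_lt_top_of_nonneg (by linarith) hh.2.ne

theorem mul_ofReal_toReal_sub_one {p q : ℝ≥0∞} [p.HolderConjugate q] (hp : 1 < p) (hp_top : p ≠ ∞) :
    q * ENNReal.ofReal (p.toReal - 1) = p := by
  have hq : q ≠ 0 := ENNReal.HolderConjugate.ne_zero q p
  have hq_top : q ≠ ∞ := (ENNReal.HolderConjugate.lt_top_iff_one_lt q p).2 hp |>.ne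
  rw [ENNReal.ofReal_sub _ zero_le_one, ENNReal.ofReal_toReal hp_top, ENNReal.ofReal_one,
    ← ENNReal.HolderConjugate.div_conj_eq_sub_one (q := q), ENNReal.mul_div_cancel hq hq_top]

theorem le_two_of_two_le_conj {p q : ℝ≥0∞} [p.HolderConjugate q] (hp : 2 ≤ p) : q ≤ 2 := by
  rw [← ENNReal.inv_le_inv, ← ENNReal.HolderConjugate.one_sub_inv p q]
  calc (2 : ℝ≥0∞)⁻¹ = 1 - 2⁻¹ := ENNReal.one_sub_inv_two.symm
    _ ≤ 1 - p⁻¹ := tsub_le_tsub_left (ENNReal.inv_le_inv.2 hp) 1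

theorem integral_norm_rpow_eq {E : Type*} [NormedAddCommGroup E] {f : α → E} {p : ℝ≥0∞}
    (hp : p ≠ 0) (hp_top : p ≠ ∞) (hf : AEStronglyMeasurable f μ) :
    ∫ x, ‖f x‖ ^ p.toReal ∂μ = (eLpNorm f p μ).toReal ^ p.toReal := by
  rw [toReal_eLpNorm hf, lpNorm_eq_integral_norm_rpow_toReal hp hp_top hf,
    Real.rpow_inv_rpow (integral_nonneg fun x ↦ by positivity) (ENNReal.toReal_pos hp hp_top).ne']

theorem toReal_eLpNorm_le_of_norm_integral_mul_dualFunction_le {p q : ℝ≥0∞} [p.HolderConjugate q]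
    {K : ℝ} (hp : 1 < p) (hp_top : p ≠ ∞) (hh : AEStronglyMeasurable h μ) (hK : 0 ≤ K)
    (h_le : ‖∫ x, h x * dualFunction p.toReal h x ∂μ‖ ≤
      K * (eLpNorm (dualFunction p.toReal h) q μ).toReal) :
    (eLpNorm h p μ).toReal ≤ K := by
  have hr : 1 < p.toReal := by simpa using (ENNReal.toReal_lt_toReal ENNReal.one_ne_top hp_top).2 hp
  have hr₀ : p.toReal ≠ 0 := (zero_lt_one.trans hr).ne'
  rw [eLpNorm_dualFunction hr, mul_ofReal_toReal_sub_one hp hp_top, ← ENNReal.toReal_rpow] at h_le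
  simp only [mul_dualFunction hr₀] at h_le
  rw [integral_complex_ofReal, Complex.norm_real,
    integral_norm_rpow_eq (zero_lt_one.trans hp).ne' hp_top hh,
    Real.norm_of_nonneg (by positivity)] at h_le
  rcases (ENNReal.toReal_nonneg (a := eLpNorm h p μ)).eq_or_lt with hN | hN
  · rwa [← hN]
  · refine le_of_mul_le_mul_right ?_ (Real.rpow_pos_of_pos hN (p.toReal - 1))
    rwa [← Real.rpow_one_add' hN.le (by simpa using hr₀), add_sub_cancel]

theorem norm_integral_mul_le {p q : ℝ≥0∞} [p.HolderConjugate q] {u v : α → ℂ}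
    (hu : MemLp u p μ) (hv : MemLp v q μ) :
    ‖∫ x, u x * v x ∂μ‖ ≤ (eLpNorm u p μ).toReal * (eLpNorm v q μ).toReal := by
  rw [← ENNReal.toReal_mul, ← toReal_enorm]
  refine ENNReal.toReal_mono (ENNReal.mul_ne_top hu.2.ne hv.2.ne) ?_
  calc ‖∫ x, u x * v x ∂μ‖ₑ ≤ ∫⁻ x, ‖u x * v x‖ₑ ∂μ := enorm_integral_le_lintegral_enorm _
    _ = eLpNorm (u • v) 1 μ := eLpNorm_one_eq_lintegral_enorm.symm
    _ ≤ eLpNorm u p μ * eLpNorm v q μ := eLpNorm_smul_le_mul_eLpNorm hv.1 hu.1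

end Duality

section DualExponents

variable {α : Type*} [MeasurableSpace α] {μ : Measure α}

theorem memLp_of_le_of_le {E : Type*} [NormedAddCommGroup E] {f : α → E} {p q r : ℝ≥0∞}
    (hfp : MemLp f p μ) (hfq : MemLp f q μ) (hp : p ≠ 0) (hpr : p ≤ r) (hrq : r ≤ q) :
    MemLp f r μ := by
  rcases eq_or_ne r ∞ with rfl | hr_top
  · rwa [top_le_iff.1 hrq] at hfq
  have hp_top : p ≠ ∞ := ne_top_of_le_ne_top hr_top hpr
  have hr : 0 < r.toReal := ENNReal.toReal_pos ((pos_iff_ne_zero.2 hp).trans_le hpr).ne' hr_top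
  obtain ⟨g, hg, hfg⟩ := hfp.1
  rw [memLp_congr_ae hfg] at hfp hfq ⊢
  set s : Set α := {x | (1 : NNReal) ≤ ‖g x‖₊}
  have hs : MeasurableSet s := measurableSet_le measurable_const hg.nnnorm.measurable
  have h_large : MemLp (s.indicator g) r μ :=
    (hfq.indicator hs).mono_exponent_of_measure_support_ne_top (s := s)
      (fun x hx ↦ Set.indicator_of_notMem hx g) (hfp.meas_ge_lt_top hp hp_top one_ne_zero).ne hrq
  have h_small : MemLp (sᶜ.indicator g) r μ := by
    refine ⟨(hg.indicator hs.compl).aestronglyMeasurable, ?_⟩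
    refine (eLpNorm_le_rpow_of_norm_le_rpow hp hp_top fun x ↦ ?_).trans_lt
      (ENNReal.rpow_lt_top_of_nonneg (by positivity) (hfp.indicator hs.compl).2.ne)
    have h_le : ‖sᶜ.indicator g x‖ ≤ 1 := by
      by_cases hx : x ∈ s
      · simp [hx]
      · rw [Set.indicator_of_mem hx]
        exact (not_le.1 hx).le
    exact Real.self_le_rpow_of_le_one (norm_nonneg _) h_le
      ((div_le_one hr).2 (ENNReal.toReal_mono hr_top hpr))
  exact (Set.indicator_self_add_compl s g) ▸ h_large.add h_small

variable {A : ℝ} {T : Lp ℂ 2 μ →L[ℂ] Lp ℂ 2 μ} {p q : ℝ≥0∞} [p.HolderConjugate q]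

theorem isBoundedFor_one_one_lpPairing_comp (hA : 0 ≤ A)
    (hT : ∀ f : Lp ℂ 2 μ, MemLp f 1 μ → eLpNorm (T f) ∞ μ ≤ ENNReal.ofReal A * eLpNorm f 1 μ) :
    IsBoundedFor ((ContinuousLinearMap.mul ℂ ℂ).lpPairing μ 2 2 ∘L T) 1 1 A := by
  intro f g hf hg
  have h_ne_top : ENNReal.ofReal A * eLpNorm f 1 μ ≠ ∞ :=
    ENNReal.mul_ne_top ENNReal.ofReal_ne_top hf.2.ne
  have hTf : MemLp (T f) ∞ μ := ⟨(Lp.memLp (T f)).1, (hT f hf).trans_lt h_ne_top.lt_top⟩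
  have : ENNReal.HolderConjugate ∞ 1 := .top_one
  rw [ContinuousLinearMap.comp_apply, ContinuousLinearMap.lpPairing_eq_integral, ← mul_assoc]
  refine (norm_integral_mul_le hTf hg).trans ?_
  gcongr
  simpa [hA] using ENNReal.toReal_mono h_ne_top (hT f hf)

theorem isBoundedFor_two_two_lpPairing_comp (T : Lp ℂ 2 μ →L[ℂ] Lp ℂ 2 μ) :
    IsBoundedFor ((ContinuousLinearMap.mul ℂ ℂ).lpPairing μ 2 2 ∘L T) 2 2 ‖T‖ := by
  intro f g _ _
  rw [ContinuousLinearMap.comp_apply, ContinuousLinearMap.lpPairing_eq_integral, ← mul_assoc]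
  refine (norm_integral_mul_le (Lp.memLp (T f)) (Lp.memLp g)).trans ?_
  gcongr
  simpa only [Lp.norm_def] using T.le_opNorm f

theorem isBoundedFor_conj_conj_lpPairing_comp (hA : 0 ≤ A)
    (hT : ∀ f : Lp ℂ 2 μ, MemLp f 1 μ → eLpNorm (T f) ∞ μ ≤ ENNReal.ofReal A * eLpNorm f 1 μ)
    (hp : 2 ≤ p) (hp_top : p ≠ ∞) :
    IsBoundedFor ((ContinuousLinearMap.mul ℂ ℂ).lpPairing μ 2 2 ∘L T) q q
      (A ^ (1 - (2 / p).toReal) * ‖T‖ ^ (2 / p).toReal) := by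
  have hp_one : 1 < p := ENNReal.one_lt_two.trans_le hp
  have hp_two : 2 ≤ p.toReal := by simpa using ENNReal.toReal_mono hp_top hp
  have hq_top : q ≠ ∞ := ((ENNReal.HolderConjugate.lt_top_iff_one_lt q p).2 hp_one).ne
  have hθ : (2 / p).toReal = 2 / p.toReal := by simp
  have hqθ : q.toReal⁻¹ = (1 - (2 / p).toReal) * (1 : ℝ≥0∞).toReal⁻¹ +
      (2 / p).toReal * (2 : ℝ≥0∞).toReal⁻¹ := by
    have h_conj := (ENNReal.HolderConjugate.toReal_of_ne_top (p := p) (q := q) hp_top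
      hq_top).inv_add_inv_eq_one
    rw [hθ, ENNReal.toReal_one, ENNReal.toReal_ofNat, eq_sub_of_add_eq' h_conj]
    ring
  exact (isBoundedFor_one_one_lpPairing_comp hA hT).interp
    (isBoundedFor_two_two_lpPairing_comp T) ENNReal.ofNat_ne_top ENNReal.ofNat_ne_top hA
    (norm_nonneg T) ENNReal.toReal_nonneg (hθ.trans_le ((div_le_one (by linarith)).2 hp_two))
    (ENNReal.HolderConjugate.one_le q p) hq_top (ENNReal.HolderConjugate.one_le q p) hq_top
    hqθ hqθ

theorem eLpNorm_apply_le_of_one_top_of_two_two (hA : 0 ≤ A)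
    (hT : ∀ f : Lp ℂ 2 μ, MemLp f 1 μ → eLpNorm (T f) ∞ μ ≤ ENNReal.ofReal A * eLpNorm f 1 μ)
    (hp : 2 ≤ p) {f : Lp ℂ 2 μ} (hf : MemLp f 1 μ) :
    eLpNorm (T f) p μ ≤ ENNReal.ofReal (A ^ (1 - (2 / p).toReal) * ‖T‖ ^ (2 / p).toReal) *
      eLpNorm f q μ := by
  rcases eq_or_ne p ∞ with rfl | hp_top
  · have hq : q = 1 := (ENNReal.HolderConjugate.eq_top_iff_eq_one ∞ q).1 rfl
    simpa [hq] using hT f hf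
  have hp_one : 1 < p := ENNReal.one_lt_two.trans_le hp
  have hp_two : 2 ≤ p.toReal := by simpa using ENNReal.toReal_mono hp_top hp
  have hTf : MemLp (T f) ∞ μ := ⟨(Lp.memLp (T f)).1, (hT f hf).trans_lt
    (ENNReal.mul_lt_top ENNReal.ofReal_lt_top hf.2)⟩
  have hTf_ge {r : ℝ≥0∞} (hr : 2 ≤ r) : MemLp (T f) r μ :=
    memLp_of_le_of_le (Lp.memLp (T f)) hTf two_ne_zero hr le_top
  have hfq : MemLp f q μ := memLp_of_le_of_le hf (Lp.memLp f) one_ne_zero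
    (ENNReal.HolderConjugate.one_le q p) (le_two_of_two_le_conj hp)
  have h_dual : MemLp (dualFunction p.toReal (T f)) 2 μ := memLp_dualFunction (by linarith)
    (hTf_ge (le_mul_of_one_le_right' (ENNReal.one_le_ofReal.2 (by linarith))))
  have h_dual_q : MemLp (dualFunction p.toReal (T f)) q μ :=
    memLp_dualFunction (by linarith)
      ((mul_ofReal_toReal_sub_one (q := q) hp_one hp_top).symm ▸ hTf_ge hp)
  have h_pair := isBoundedFor_conj_conj_lpPairing_comp (q := q) hA hT hp hp_top f
    (h_dual.toLp _) hfq ((memLp_congr_ae h_dual.coeFn_toLp).2 h_dual_q)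
  rw [ContinuousLinearMap.comp_apply, ContinuousLinearMap.lpPairing_eq_integral,
    eLpNorm_congr_ae h_dual.coeFn_toLp, ← mul_assoc, integral_congr_ae
    (h_dual.coeFn_toLp.mono fun x hx ↦ congrArg (ContinuousLinearMap.mul ℂ ℂ (T f x)) hx)] at h_pair
  have h_le := toReal_eLpNorm_le_of_norm_integral_mul_dualFunction_le hp_one hp_top hTf.1
    (by positivity) h_pair
  rw [← ENNReal.ofReal_toReal (hTf_ge hp).2.ne, ← ENNReal.ofReal_toReal hfq.2.ne,
    ← ENNReal.ofReal_mul (by positivity)]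
  exact ENNReal.ofReal_le_ofReal h_le

end DualExponents

section FourierMultiplier

open FourierTransform

variable {V : Type*} [NormedAddCommGroup V] [InnerProductSpace ℝ V] [MeasurableSpace V]
  [BorelSpace V] [FiniteDimensional ℝ V]

theorem continuous_fourier {f : V → ℂ} (hf : Integrable f) : Continuous (𝓕 f) :=
  VectorFourier.fourierIntegral_continuous Real.continuous_fourierChar
    (by exact continuous_inner) hf

theorem continuous_fourierInv {f : V → ℂ} (hf : Integrable f) : Continuous (𝓕⁻ f) := by
  rw [Real.fourierInv_eq_fourier_comp_neg]
  exact continuous_fourier hf.comp_neg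

theorem norm_fourier_le (f : V → ℂ) (ξ : V) : ‖𝓕 f ξ‖ ≤ ∫ x, ‖f x‖ :=
  VectorFourier.norm_fourierIntegral_le_integral_norm _ _ _ _ _

theorem integral_fourier_mul {f g : V → ℂ} (hf : Integrable f) (hg : Integrable g) :
    ∫ ξ, 𝓕 f ξ * g ξ = ∫ x, f x * 𝓕 g x := by
  simpa using! VectorFourier.integral_fourierIntegral_smul_eq_flip (L := innerₗ V)
    Real.continuous_fourierChar continuous_inner hf hg

theorem integral_fourierInv_mul {f g : V → ℂ} (hf : Integrable f) (hg : Integrable g) :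
    ∫ ξ, 𝓕⁻ f ξ * g ξ = ∫ x, f x * 𝓕⁻ g x := by
  simp only [Real.fourierInv_eq_fourier_neg]
  rw [← integral_neg_eq_self]
  simp only [neg_neg]
  rw [integral_fourier_mul hf hg.comp_neg]
  simp only [Real.fourierInv_eq_fourier_comp_neg, ← Real.fourierInv_eq_fourier_neg]

theorem ae_eq_of_integral_schwartzMap_mul_eq {f g : V → ℂ} (hf : LocallyIntegrable f)
    (hg : LocallyIntegrable g) (h : ∀ ψ : 𝓢(V, ℂ), ∫ x, ψ x * f x = ∫ x, ψ x * g x) :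
    f =ᵐ[volume] g := by
  refine ae_eq_of_integral_contDiff_smul_eq hf hg fun u hu hu_supp ↦ ?_
  have hψ_supp : HasCompactSupport (Complex.ofRealCLM ∘ u) := hu_supp.comp_left rfl
  exact h (hψ_supp.toSchwartzMap (by fun_prop))

theorem fourier_toLp_ae_eq {f : V → ℂ} (h₁ : Integrable f) (h₂ : MemLp f 2) :
    (𝓕 (h₂.toLp f) : Lp ℂ 2 (volume : Measure V)) =ᵐ[volume] 𝓕 f := by
  refine ae_eq_of_integral_schwartzMap_mul_eq ((Lp.memLp _).locallyIntegrable one_le_two)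
    (continuous_fourier h₁).locallyIntegrable fun ψ ↦ ?_
  have h_distrib := DFunLike.congr_fun (Lp.fourier_toTemperedDistribution_eq (h₂.toLp f)) ψ
  simp only [TemperedDistribution.fourier_apply, Lp.toTemperedDistribution_apply, smul_eq_mul]
    at h_distrib
  rw [← h_distrib, ← integral_fourier_mul ψ.integrable h₁]
  exact integral_congr_ae (h₂.coeFn_toLp.mono fun x hx ↦ by simp only [hx, SchwartzMap.fourier_coe])

theorem fourierInv_toLp_ae_eq {f : V → ℂ} (h₁ : Integrable f) (h₂ : MemLp f 2) :
    (𝓕⁻ (h₂.toLp f) : Lp ℂ 2 (volume : Measure V)) =ᵐ[volume] 𝓕⁻ f := by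
  refine ae_eq_of_integral_schwartzMap_mul_eq ((Lp.memLp _).locallyIntegrable one_le_two)
    (continuous_fourierInv h₁).locallyIntegrable fun ψ ↦ ?_
  have h_distrib := DFunLike.congr_fun (Lp.fourierInv_toTemperedDistribution_eq (h₂.toLp f)) ψ
  simp only [TemperedDistribution.fourierInv_apply, Lp.toTemperedDistribution_apply, smul_eq_mul]
    at h_distrib
  rw [← h_distrib, ← integral_fourierInv_mul ψ.integrable h₁]
  exact integral_congr_ae
    (h₂.coeFn_toLp.mono fun x hx ↦ by simp only [hx, SchwartzMap.fourierInv_coe])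

theorem norm_fourierInv_mul_fourier_le {k f : V → ℂ} (hk : Integrable k) {A : ℝ}
    (hA : ∀ x, ‖𝓕⁻ k x‖ ≤ A) (hf : Integrable f) (x : V) :
    ‖𝓕⁻ (fun ξ ↦ k ξ * 𝓕 f ξ) x‖ ≤ A * ∫ y, ‖f y‖ := by
  have hint : Integrable fun ξ ↦ Real.fourierChar (inner ℝ ξ x) • k ξ :=
    hk.mono (by fun_prop) (.of_forall fun ξ ↦ (Circle.norm_smul _ _).le)
  have translate (y : V) :
      𝓕 (fun ξ ↦ Real.fourierChar (inner ℝ ξ x) • k ξ) y = 𝓕⁻ k (x - y) := by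
    rw [Real.fourier_eq, Real.fourierInv_eq]
    refine integral_congr_ae (.of_forall fun ξ ↦ ?_)
    simp only [smul_smul, ← AddChar.map_add_eq_mul, inner_sub_right, neg_add_eq_sub]
  have convolution : 𝓕⁻ (fun ξ ↦ k ξ * 𝓕 f ξ) x = ∫ y, 𝓕⁻ k (x - y) * f y := by
    simp only [← translate, integral_fourier_mul hint hf]
    simp only [Real.fourierInv_eq, smul_mul_assoc]
  rw [convolution, ← integral_const_mul]
  refine norm_integral_le_of_norm_le (hf.norm.const_mul A) (.of_forall fun y ↦ ?_)
  rw [norm_mul]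
  exact mul_le_mul_of_nonneg_right (hA _) (norm_nonneg _)

/-- The Fourier multiplier with the bounded symbol `m`, as an operator on `L²`. -/
noncomputable def l2Multiplier (m : Lp ℂ ∞ (volume : Measure V)) :
    Lp ℂ 2 (volume : Measure V) →L[ℂ] Lp ℂ 2 (volume : Measure V) :=
  fourierInvCLM ℂ (Lp ℂ 2 (volume : Measure V)) ∘L
    (ContinuousLinearMap.mul ℂ ℂ).holderL volume ∞ 2 2 m ∘L
      fourierCLM ℂ (Lp ℂ 2 (volume : Measure V))

theorem l2Multiplier_apply (m : Lp ℂ ∞ (volume : Measure V)) (f : Lp ℂ 2 (volume : Measure V)) :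
    l2Multiplier m f = 𝓕⁻ ((ContinuousLinearMap.mul ℂ ℂ).holder 2 m (𝓕 f)) := rfl

theorem norm_l2Multiplier_le (m : Lp ℂ ∞ (volume : Measure V)) : ‖l2Multiplier m‖ ≤ ‖m‖ := by
  refine ContinuousLinearMap.opNorm_le_bound _ (norm_nonneg m) fun f ↦ ?_
  rw [l2Multiplier_apply, ← Lp.norm_fourier_eq, fourier_fourierInv_eq]
  simpa using (ContinuousLinearMap.mul ℂ ℂ).norm_holder_apply_apply_le (r := 2) m (𝓕 f)

theorem l2Multiplier_toLp_ae_eq {k f : V → ℂ} (hk : Integrable k) (hk_top : MemLp k ∞)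
    (hf : Integrable f) (hf₂ : MemLp f 2) :
    l2Multiplier (hk_top.toLp k) (hf₂.toLp f) =ᵐ[volume] 𝓕⁻ (fun ξ ↦ k ξ * 𝓕 f ξ) := by
  have hprod : (ContinuousLinearMap.mul ℂ ℂ).holder 2 (hk_top.toLp k) (𝓕 (hf₂.toLp f)) =ᵐ[volume]
      fun ξ ↦ k ξ * 𝓕 f ξ := by
    filter_upwards [ContinuousLinearMap.coeFn_holder (r := 2) (.mul ℂ ℂ) (hk_top.toLp k)
      (𝓕 (hf₂.toLp f)), hk_top.coeFn_toLp, fourier_toLp_ae_eq hf hf₂] with ξ h_mul h_k h_f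
    rw [h_mul, h_k, h_f, ContinuousLinearMap.mul_apply']
  have hprod₂ : MemLp (fun ξ ↦ k ξ * 𝓕 f ξ) 2 := (memLp_congr_ae hprod).1 (Lp.memLp _)
  have hprod₁ : Integrable fun ξ ↦ k ξ * 𝓕 f ξ :=
    hk.mul_bdd (continuous_fourier hf).aestronglyMeasurable (.of_forall (norm_fourier_le f))
  rw [l2Multiplier_apply, Lp.ext (hprod.trans hprod₂.coeFn_toLp.symm)]
  exact fourierInv_toLp_ae_eq hprod₁ hprod₂

theorem eLpNorm_l2Multiplier_top_le {k : V → ℂ} (hk : Integrable k) (hk_top : MemLp k ∞) {A : ℝ}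
    (hA : ∀ x, ‖𝓕⁻ k x‖ ≤ A) {f : Lp ℂ 2 (volume : Measure V)} (hf : Integrable f) :
    eLpNorm (l2Multiplier (hk_top.toLp k) f) ∞ volume ≤
      ENNReal.ofReal A * eLpNorm f 1 volume := by
  have h_formula : l2Multiplier (hk_top.toLp k) f =ᵐ[volume]
      𝓕⁻ (fun ξ ↦ k ξ * 𝓕 (f : V → ℂ) ξ) := by
    simpa only [Lp.toLp_coeFn] using l2Multiplier_toLp_ae_eq hk hk_top hf (Lp.memLp f)
  rw [eLpNorm_congr_ae h_formula, eLpNorm_exponent_top]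
  refine (eLpNormEssSup_le_of_ae_bound
    (.of_forall (norm_fourierInv_mul_fourier_le hk hA hf))).trans_eq ?_
  rw [ENNReal.ofReal_mul ((norm_nonneg _).trans (hA 0)),
    ofReal_integral_norm_eq_lintegral_enorm hf, eLpNorm_one_eq_lintegral_enorm]

theorem fourierMultiplierCLM_eq_fourierInv {k : V → ℂ} (hk : k.HasTemperateGrowth) (f : 𝓢(V, ℂ)) :
    SchwartzMap.fourierMultiplierCLM ℂ k f = 𝓕⁻ (fun ξ ↦ k ξ * 𝓕 (f : V → ℂ) ξ) := by
  rw [SchwartzMap.fourierMultiplierCLM_apply, SchwartzMap.fourierInv_coe]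
  refine congrArg (𝓕⁻ · : (V → ℂ) → V → ℂ) (funext fun ξ ↦ ?_)
  rw [SchwartzMap.smulLeftCLM_apply_apply hk, SchwartzMap.fourier_coe, smul_eq_mul]

theorem eLpNorm_fourierMultiplierCLM_le {k : V → ℂ} (hk : k.HasTemperateGrowth)
    (hk_int : Integrable k) {M A : ℝ} (hM : ∀ ξ, ‖k ξ‖ ≤ M) (hA : ∀ x, ‖𝓕⁻ k x‖ ≤ A)
    {p q : ℝ≥0∞} [p.HolderConjugate q] (hp : 2 ≤ p) (f : 𝓢(V, ℂ)) :
    eLpNorm (SchwartzMap.fourierMultiplierCLM ℂ k f) p volume ≤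
      ENNReal.ofReal (A ^ (1 - (2 / p).toReal) * M ^ (2 / p).toReal) * eLpNorm f q volume := by
  have hA0 : 0 ≤ A := (norm_nonneg _).trans (hA 0)
  have hM0 : 0 ≤ M := (norm_nonneg _).trans (hM 0)
  have hk_top : MemLp k ∞ := memLp_top_of_bound hk_int.1 M (.of_forall hM)
  have h_norm : ‖l2Multiplier (hk_top.toLp k)‖ ≤ M := by
    refine (norm_l2Multiplier_le _).trans ?_
    rw [Lp.norm_toLp]
    exact ENNReal.toReal_le_of_le_ofReal hM0 (eLpNormEssSup_le_of_ae_bound (.of_forall hM))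
  have h_apply : l2Multiplier (hk_top.toLp k) (f.toLp 2) =ᵐ[volume]
      SchwartzMap.fourierMultiplierCLM ℂ k f := by
    rw [fourierMultiplierCLM_eq_fourierInv hk]
    exact l2Multiplier_toLp_ae_eq hk_int hk_top f.integrable (f.memLp 2)
  rw [← eLpNorm_congr_ae h_apply, ← eLpNorm_congr_ae (f.coeFn_toLp 2 volume)]
  refine (eLpNorm_apply_le_of_one_top_of_two_two (q := q) hA0
    (fun g hg ↦ eLpNorm_l2Multiplier_top_le hk_int hk_top hA (memLp_one_iff_integrable.1 hg)) hp
    ((memLp_congr_ae (f.coeFn_toLp 2 volume)).2 (f.memLp 1))).trans ?_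
  gcongr

end FourierMultiplier

section SobolevNorm

open FourierTransform

variable {σ : ℝ}

/-- The symbol of `J^σ S(t)` with respect to Mathlib's Fourier transform, in which `D` has the
symbol `2πξ`. -/
noncomputable def kernelSymbol (σ t ξ : ℝ) : ℂ :=
  groupSymbol t (2 * Real.pi * ξ) * besselSymbol σ (2 * Real.pi * ξ)

theorem hasTemperateGrowth_kernelSymbol (σ t : ℝ) : (kernelSymbol σ t).HasTemperateGrowth :=
  (hasTemperateGrowth_groupSymbol t).mul (hasTemperateGrowth_besselSymbol σ)

theorem cexp_mul_kernelSymbol (σ x t ξ : ℝ) :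
    Complex.exp ((x * (2 * Real.pi * ξ) : ℝ) * Complex.I) * kernelSymbol σ t ξ =
      kernelIntegrand σ x t (2 * Real.pi * ξ) := by
  rw [kernelSymbol, kernelIntegrand, groupSymbol, besselSymbol, ← mul_assoc, ← Complex.exp_add,
    Complex.real_smul, mul_comm]
  congr 2
  push_cast
  ring

theorem kernelSymbol_eq_kernelIntegrand (σ t ξ : ℝ) :
    kernelSymbol σ t ξ = kernelIntegrand σ 0 t (2 * Real.pi * ξ) := by
  simp [← cexp_mul_kernelSymbol]

theorem integrable_kernelSymbol (hσ : σ < -1) (t : ℝ) : Integrable (kernelSymbol σ t) := by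
  simpa only [← kernelSymbol_eq_kernelIntegrand] using
    (integrable_kernelIntegrand hσ 0 t).comp_mul_left' Real.two_pi_pos.ne'

theorem norm_kernelSymbol_le_one (hσ : σ ≤ 0) (t ξ : ℝ) : ‖kernelSymbol σ t ξ‖ ≤ 1 := by
  rw [kernelSymbol_eq_kernelIntegrand, norm_kernelIntegrand]
  exact one_add_sq_rpow_le_one (by linarith) _

theorem fourierInv_kernelSymbol (σ t x : ℝ) :
    𝓕⁻ (kernelSymbol σ t) x = (2 * Real.pi)⁻¹ • ∫ η, kernelIntegrand σ x t η := by
  rw [← abs_of_pos (inv_pos.2 Real.two_pi_pos), ← Measure.integral_comp_mul_left,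
    Real.fourierInv_eq']
  refine integral_congr_ae (.of_forall fun ξ ↦ ?_)
  simp only [← cexp_mul_kernelSymbol, smul_eq_mul, RCLike.inner_apply, conj_trivial]
  rw [mul_left_comm x]

theorem norm_fourierInv_kernelSymbol_le (σ t x : ℝ) :
    ‖𝓕⁻ (kernelSymbol σ t) x‖ ≤ ‖∫ η, kernelIntegrand σ x t η‖ := by
  rw [fourierInv_kernelSymbol, norm_smul, Real.norm_of_nonneg (by positivity)]
  exact mul_le_of_le_one_left (norm_nonneg _)
    (inv_le_one_of_one_le₀ (by linarith [Real.pi_gt_three]))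

theorem bessel_group_apply (σ t : ℝ) (f : 𝓢(ℝ, ℂ)) :
    bessel σ (group t (f : 𝓢'(ℝ, ℂ))) =
      (SchwartzMap.fourierMultiplierCLM ℂ (kernelSymbol σ t) f : 𝓢(ℝ, ℂ)) := by
  rw [bessel, group, multiplier, multiplier,
    TemperedDistribution.fourierMultiplierCLM_fourierMultiplierCLM_apply
      (hasTemperateGrowth_groupSymbol t) (hasTemperateGrowth_besselSymbol σ)]
  exact TemperedDistribution.fourierMultiplierCLM_toTemperedDistributionCLM_eq
    (hasTemperateGrowth_kernelSymbol σ t) f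

theorem sobolevNorm_group_le (σ t : ℝ) (p : ℝ≥0∞) (f : 𝓢(ℝ, ℂ)) :
    sobolevNorm σ p (group t (f : 𝓢'(ℝ, ℂ))) ≤
      eLpNorm (SchwartzMap.fourierMultiplierCLM ℂ (kernelSymbol σ t) f) p volume := by
  refine iInf₂_le_of_le _ (SchwartzMap.memLp _ p volume) (iInf_le_of_le (fun ψ ↦ ?_) le_rfl)
  simp [bessel_group_apply]

theorem sobolevNorm_group_le_of_norm_integral_le (hσ : σ < -1) {t A : ℝ}
    (hA : ∀ x, ‖∫ η, kernelIntegrand σ x t η‖ ≤ A) {p q : ℝ≥0∞} [p.HolderConjugate q] (hp : 2 ≤ p)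
    (f : 𝓢(ℝ, ℂ)) :
    sobolevNorm σ p (group t (f : 𝓢'(ℝ, ℂ))) ≤
      ENNReal.ofReal (A ^ (1 - (2 / p).toReal)) * eLpNorm f q volume := by
  simpa only [Real.one_rpow, mul_one] using (sobolevNorm_group_le σ t p f).trans
    (eLpNorm_fourierMultiplierCLM_le (hasTemperateGrowth_kernelSymbol σ t)
      (integrable_kernelSymbol hσ t) (norm_kernelSymbol_le_one (by linarith) t)
      (fun x ↦ (norm_fourierInv_kernelSymbol_le σ t x).trans (hA x)) hp f)

end SobolevNorm

section Exponents

variable {σ : ℝ}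

theorem decayRate_le_beta (hσ : σ < -1) : decayRate σ ≤ beta σ := by
  refine max_le ?_ ?_ <;> unfold beta <;> split_ifs with h
  · rw [div_le_div_iff₀ (by norm_num) (by linarith)]
    linarith
  · rw [div_le_div_iff₀ (by norm_num) (by linarith)]
    linarith
  · exact le_rfl
  · exact div_le_div_of_nonneg_right (by linarith) (by linarith)

theorem beta_nonpos (hσ : σ < -1) : beta σ ≤ 0 := by
  unfold beta
  split_ifs <;> exact div_nonpos_of_nonpos_of_nonneg (by linarith) (by linarith)

theorem max_one_rpow_le_rpow {r a b : ℝ} (hr : 0 < r) (hab : a ≤ b) (hb : b ≤ 0) :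
    max 1 r ^ a ≤ r ^ b := by
  rcases le_total 1 r with h | h
  · rw [max_eq_right h]
    exact Real.rpow_le_rpow_of_exponent_le h hab
  · rw [max_eq_left h, Real.one_rpow]
    exact Real.one_le_rpow_of_pos_of_le_one_of_nonpos hr h hb

theorem max_one_abs_rpow_mul_decayRate_le (hσ : σ < -1) {t θ : ℝ} (ht : t ≠ 0) (hθ : 0 ≤ θ) :
    max 1 |t| ^ (θ * decayRate σ) ≤ |t| ^ (θ * beta σ) :=
  max_one_rpow_le_rpow (abs_pos.2 ht) (mul_le_mul_of_nonneg_left (decayRate_le_beta hσ) hθ)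
    (mul_nonpos_of_nonneg_of_nonpos hθ (beta_nonpos hσ))

theorem mul_rpow_le_mul_rpow {C r θ d : ℝ} (hC : 1 ≤ C) (hr : 0 ≤ r) (hθ : θ ≤ 1) :
    (C * r ^ d) ^ θ ≤ C * r ^ (θ * d) := by
  rw [Real.mul_rpow (by positivity) (by positivity), ← Real.rpow_mul hr, mul_comm d]
  gcongr
  exact Real.rpow_le_self_of_one_le hC hθ

theorem one_sub_toReal_two_div (p : ℝ≥0∞) :
    1 - (2 / p).toReal = 2 * (1 / 2 - (1 / p).toReal) := by
  rw [ENNReal.toReal_div, ENNReal.toReal_div, ENNReal.toReal_ofNat, ENNReal.toReal_one]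
  ring

theorem toReal_one_div_le_half {p : ℝ≥0∞} (hp : 2 ≤ p) : (1 / p).toReal ≤ 1 / 2 := by
  simpa using ENNReal.toReal_mono (by simp) (ENNReal.inv_le_inv.2 hp)

end Exponents

end BBM

theorem mainTheorem9_general {σ : ℝ} (hσ : σ < -1) :
    ∃ C : ℝ, 0 < C ∧
      ∀ p p' : ℝ≥0∞, 2 ≤ p → 1 / p + 1 / p' = 1 →
        ∀ (f : 𝓢(ℝ, ℂ)) (t : ℝ),
          BBM.sobolevNorm σ p (BBM.group t (f : 𝓢'(ℝ, ℂ))) ≤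
            ENNReal.ofReal (C * max 1 |t| ^ (2 * (1 / 2 - (1 / p).toReal) * BBM.decayRate σ)) *
              eLpNorm f p' volume := by
  obtain ⟨C, hK⟩ := BBM.exists_norm_integral_kernelIntegrand_le hσ
  refine ⟨max 1 C, by positivity, fun p p' hp hpp' f t ↦ ?_⟩
  have : p.HolderConjugate p' := ENNReal.holderConjugate_iff.2 (by simpa using hpp')
  have kernel_bound (x : ℝ) : ‖∫ η, BBM.kernelIntegrand σ x t η‖ ≤
      max 1 C * max 1 |t| ^ BBM.decayRate σ :=
    (hK x t).trans (by gcongr; exact le_max_right 1 C)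
  refine (BBM.sobolevNorm_group_le_of_norm_integral_le (q := p') hσ kernel_bound hp f).trans ?_
  rw [BBM.one_sub_toReal_two_div]
  gcongr
  exact BBM.mul_rpow_le_mul_rpow (le_max_left 1 C) (by positivity)
    (by linarith [(1 / p).toReal_nonneg])

/-- For `σ < -1` there is a constant `C_σ > 0`, depending on `σ` only, such that for all
`2 ≤ p ≤ ∞`, `1/p + 1/p' = 1`, all Schwartz functions `f` and all `t ≠ 0`,
`‖S(t) f‖_{H^σ_p} ≤ C_σ |t|^{2 (1/2 - 1/p) β_σ} ‖f‖_{L^{p'}}`. -/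
theorem mainTheorem9 (σ : ℝ) (hσ : σ < -1) :
    ∃ C : ℝ, 0 < C ∧
      ∀ p p' : ℝ≥0∞, 2 ≤ p → 1 / p + 1 / p' = 1 →
        ∀ (f : 𝓢(ℝ, ℂ)) (t : ℝ), t ≠ 0 →
          BBM.sobolevNorm σ p (BBM.group t (f : 𝓢'(ℝ, ℂ))) ≤
            ENNReal.ofReal (C * |t| ^ (2 * (1 / 2 - (1 / p).toReal) * BBM.beta σ)) *
              eLpNorm f p' volume := by
  obtain ⟨C, hC, hS⟩ := mainTheorem9_general hσ
  refine ⟨C, hC, fun p p' hp hpp' f t ht ↦ (hS p p' hp hpp' f t).trans ?_⟩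
  gcongr
  exact BBM.max_one_abs_rpow_mul_decayRate_le hσ ht (by linarith [BBM.toReal_one_div_le_half hp])
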